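/- **Setting.** Let $d=2$, let $L\ge 3$ be an odd integer and let $\mathbb T^2=[-\tfrac12,\tfrac12)^2$. For $n\ge 0$ let $\Lambda_{-n}=\{-\tfrac12(1-L^{-n}),\dots,-L^{-n},0,L^{-n},\dots,\tfrac12(1-L^{-n})\}^2$, and for $x\in\Lambda_{-n}$ let $\square_{-n}(x)$ be the half-open square of side $L^{-n}$ centred at $x$; these squares partition $\mathbb T^2$. A function on $\Lambda_{-n}$ is identified with the function on $\mathbb T^2$ that is constant on each of these squares. For $w\in L^1(\mathbb T^2)$ let $\underline Q_{-n}w(x)=L^{2n}\int_{\square_{-n}(x)}w$ for $x\in\Lambda_{-n}$, and for $n\ge1$ let $\underline P_{-n}=\underline Q_{-n}-\underline Q_{-n+1}$. On $\Lambda_{-N}$ let $-\underline\Delta_H=\sum_{n=1}^N L^{2n}\underline P_{-n}$. For $\beta>0$ let $$\|w\|_{\mathcal C^\beta}=|\underline Q_0w|+\sup_{n\ge1}L^{\beta n}\sup_{x\in\mathbb T^2}|\underline P_{-n}w(x)|,$$ and let $\mathcal C^\beta(\mathbb T^2)$ be the completion, under this norm, of the functions that are constant on the squares of some scale $n$. Let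 $\xi$ be white noise on $\mathbb T^2$, i.e. a centred Gaussian process $(\xi(f))_{f\in L^2(\mathbb T^2)}$ with $\mathbb E[\xi(f)\xi(h)]=\langle f,h\rangle_{L^2}$, on a probability space $(\Omega,\mathcal F,\mathbb P)$. Let $\underline\xi_N(x)=L^{2N}\xi(1_{\square_{-N}(x)})$ for $x\in\Lambda_{-N}$ (i.i.d. $\mathcal N(0,L^{2N})$ for fixed $N$). Put $\xi_{-n}=L^{-n}\underline\xi_n$ and, for $0\le n\le N$, $$X^{(N)}_{-n}=\underline Q_{-n}\big(\xi_{-N}\,\Gamma_{N-n}\xi_{-N}-\mathbb E[\xi_{-N}\,\Gamma_{N-n}\xi_{-N}]\big),\qquad \Gamma_{N-n}=\sum_{k=1}^{N-n}L^{2(k-1)}\underline P_{-(N-k+1)}.$$ For $\kappa_s>0$ and $g>0$ define the event $$E_g=\Big\{\sup_{N\ge0}\max_{0\le n\le N}L^{-\kappa_sn}\max_{x\in\Lambda_{-n}}\big(|\xi_{-n}(x)|\vee|X^{(N)}_{-n}(x)|^{1/2}\big)\le\tfrac1{2g}\Big\}.$$ **Theorem 1.1.** There is $\kappa_0>0$ such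 that the following holds for every fixed $\kappa_s\in(0,\kappa_0)$. Let $r\ge1$. Then for every odd $L\ge 3$ that is sufficiently large, depending only on $r$ (and on the fixed $\kappa_s$), there are constants $C,c>0$, depending only on $L$, $r$ and $\kappa_s$, such that for every $g\in(0,1]$ there is an event $\Omega_g\subseteq E_g$ with $\mathbb P(E_g\setminus\Omega_g)=0$ and $$\mathbb P(\Omega_g)\ge 1-Ce^{-cg^{-2}}$$ on which the following holds. For every $N\ge0$ the equation $$(-\underline\Delta_H)u_N=\big(g\,\underline\xi_N+r-(1-L^{-2})Ng^2\big)u_N+1\qquad\text{on }\Lambda_{-N}$$ has a unique solution $u_N:\Lambda_{-N}\to\mathbb R$, and there is a function $u^\star$ on $\mathbb T^2$ such that, for every $\kappa\in(0,1)$, $u^\star\in\mathcal C^{1-\kappa}(\mathbb T^2)$ and $\|u_N-u^\star\|_{\mathcal C^{1-\kappa}}\to0$ as $N\to\infty$. -/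

import Mathlib

open MeasureTheory ProbabilityTheory Filter Topology Set
open scoped ENNReal

noncomputable section

namespace HierAnderson

/-! ### Torus, lattices and boxes (dimension two) -/

/-- The torus, represented by its fundamental domain `[-1/2, 1/2)²`. -/
def torus : Set (Fin 2 → ℝ) := {y | ∀ i, y i ∈ Ico (-(1 / 2) : ℝ) (1 / 2)}

/-- Lebesgue measure on the torus. -/
def torusMeasure : Measure (Fin 2 → ℝ) := volume.restrict torus

/-- Labels of the points of the lattice of spacing `L⁻ⁿ` in the torus (`Lⁿ` points per direction).
Rescaling the lattice to unit spacing does not change the labels, so that functions on the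
rescaled lattice (with side length `Lⁿ`) are functions on the same type. -/
abbrev Lat (L n : ℕ) : Type := Fin 2 → Fin (L ^ n)

/-- The lattice point with label `x`; for odd `L` its coordinates run through
`-(1 - L⁻ⁿ)/2, …, -L⁻ⁿ, 0, L⁻ⁿ, …, (1 - L⁻ⁿ)/2`. -/
def pt (L n : ℕ) (x : Lat L n) : Fin 2 → ℝ :=
  fun i => (((x i : ℕ) : ℝ) + 1 / 2) / (L : ℝ) ^ n - 1 / 2

/-- The half-open square of side length `L⁻ⁿ` centred at the lattice point `x`. -/
def box (L n : ℕ) (x : Lat L n) : Set (Fin 2 → ℝ) :=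
  {y | ∀ i, y i ∈ Ico (pt L n x i - 1 / (2 * (L : ℝ) ^ n)) (pt L n x i + 1 / (2 * (L : ℝ) ^ n))}

lemma measurableSet_box (L n : ℕ) (x : Lat L n) : MeasurableSet (box L n x) := by
  have h : box L n x = Set.pi univ (fun i =>
      Ico (pt L n x i - 1 / (2 * (L : ℝ) ^ n)) (pt L n x i + 1 / (2 * (L : ℝ) ^ n))) := by
    ext y; simp only [box, mem_ofPred_eq, mem_univ_pi]
  rw [h]
  exact MeasurableSet.univ_pi fun _ => measurableSet_Ico

lemma torusMeasure_ne_top (s : Set (Fin 2 → ℝ)) : torusMeasure s ≠ ∞ := by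
  have h : torus = Set.pi univ (fun _ : Fin 2 => Ico (-(1 / 2) : ℝ) (1 / 2)) := by
    ext y; simp only [torus, mem_ofPred_eq, mem_univ_pi]
  have h1 : torusMeasure s ≤ volume torus := by
    rw [torusMeasure]
    exact (measure_mono (subset_univ s)).trans (by rw [Measure.restrict_apply_univ])
  refine ne_top_of_le_ne_top ?_ h1
  rw [h, volume_pi_pi]
  simp [Real.volume_Ico]

/-- A lattice function, viewed as the function on the torus that is constant on each box of side
length `L⁻ⁿ` (and, for definiteness, `0` outside the fundamental domain). -/
def step (L n : ℕ) (f : Lat L n → ℝ) : (Fin 2 → ℝ) → ℝ :=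
  fun y => ∑ x : Lat L n, (box L n x).indicator (fun _ => f x) y

/-! ### Averaging and fluctuation operators, hierarchical Laplacian, Hölder–Besov norm -/

/-- The averaging operator at scale `L⁻ⁿ` for functions on the torus. -/
def torusAvg (L n : ℕ) (w : (Fin 2 → ℝ) → ℝ) (x : Lat L n) : ℝ :=
  (L : ℝ) ^ (2 * n) * ∫ y in box L n x, w y

/-- The fluctuation operator at scale `L⁻ⁿ`, `n ≥ 1`, for functions on the torus. -/
def torusFluct (L n : ℕ) (w : (Fin 2 → ℝ) → ℝ) : (Fin 2 → ℝ) → ℝ :=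
  fun y => step L n (torusAvg L n w) y - step L (n - 1) (torusAvg L (n - 1) w) y

open scoped Classical in
/-- The averaging operator at scale `L⁻ⁿ`, `n ≤ N`, for functions on the lattice of
spacing `L⁻ᴺ`. -/
def latAvg (L N n : ℕ) (f : Lat L N → ℝ) (x : Lat L n) : ℝ :=
  ((L : ℝ) ^ (2 * (N - n)))⁻¹ * ∑ y : Lat L N with pt L N y ∈ box L n x, f y

/-- The fluctuation operator at scale `L⁻ⁿ`, `1 ≤ n ≤ N`, for functions on the lattice of
spacing `L⁻ᴺ`; its values are again viewed as functions on that lattice. -/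
def latFluct (L N n : ℕ) (f : Lat L N → ℝ) : Lat L N → ℝ :=
  fun x => step L n (latAvg L N n f) (pt L N x) - step L (n - 1) (latAvg L N (n - 1) f) (pt L N x)

/-- Minus the hierarchical Laplace operator on the lattice of spacing `L⁻ᴺ`. -/
def negLaplacian (L N : ℕ) (f : Lat L N → ℝ) : Lat L N → ℝ :=
  fun x => ∑ n ∈ Finset.Icc 1 N, (L : ℝ) ^ (2 * n) * latFluct L N n f x

/-- The hierarchical Hölder–Besov norm of exponent `β` of an integrable function on the torus,
with values in `[0, ∞]`. -/
def besovNorm (L : ℕ) (β : ℝ) (w : (Fin 2 → ℝ) → ℝ) : ℝ≥0∞ :=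
  ENNReal.ofReal |∫ y in torus, w y| +
    ⨆ (n : ℕ) (_ : 1 ≤ n) (y : Fin 2 → ℝ) (_ : y ∈ torus),
      ENNReal.ofReal ((L : ℝ) ^ (β * n) * |torusFluct L n w y|)

/-- Membership in the hierarchical Hölder–Besov space of exponent `β > 0`: integrable functions of
finite norm in the norm closure of the smooth functions of the hierarchical setting, i.e. of the
functions that are constant on the boxes of some scale. (For `β > 0` the norm dominates the
supremum norm up to null sets, so the completion is realised inside integrable functions.) -/
structure MemBesov (L : ℕ) (β : ℝ) (w : (Fin 2 → ℝ) → ℝ) : Prop where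
  integrable : IntegrableOn w torus
  norm_lt_top : besovNorm L β w < ∞
  approx : ∀ ε : ℝ≥0∞, 0 < ε →
    ∃ (n : ℕ) (f : Lat L n → ℝ), besovNorm L β (fun y => w y - step L n f y) < ε

/-! ### White noise and the enhanced noise -/

section Noise

variable {Ω : Type*} [MeasurableSpace Ω]

/-- White noise on the torus: a centred Gaussian process indexed by `L²` of the torus, whose
covariance is the inner product. -/
structure IsWhiteNoise (ξ : Lp ℝ 2 torusMeasure → Ω → ℝ) (P : Measure Ω) : Prop where
  gaussian : IsGaussianProcess ξ P
  mean_zero : ∀ f, ∫ ω, ξ f ω ∂P = 0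
  covariance : ∀ f g, ∫ ω, ξ f ω * ξ g ω ∂P = inner ℝ f g

/-- The indicator function of a box, as an element of `L²` of the torus. -/
def boxInd (L n : ℕ) (x : Lat L n) : Lp ℝ 2 torusMeasure :=
  indicatorConstLp 2 (measurableSet_box L n x) (torusMeasure_ne_top _) 1

/-- The regularised noise on the lattice of spacing `L⁻ᴺ`: the averages of the white noise over
the boxes. These are independent centred Gaussian variables of variance `L²ᴺ`. -/
def latNoise (ξ : Lp ℝ 2 torusMeasure → Ω → ℝ) (L N : ℕ) (ω : Ω) (x : Lat L N) : ℝ :=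
  (L : ℝ) ^ (2 * N) * ξ (boxInd L N x) ω

/-- The noise rescaled to the unit lattice of side length `Lⁿ`, of unit variance. -/
def unitNoise (ξ : Lp ℝ 2 torusMeasure → Ω → ℝ) (L n : ℕ) (ω : Ω) (x : Lat L n) : ℝ :=
  ((L : ℝ) ^ n)⁻¹ * latNoise ξ L n ω x

/-- The fluctuation propagator `∑_{k=1}^{N-n} L^{2(k-1)} P_k` on the unit lattice of side length
`Lᴺ`, where `P_k` is the rescaled fluctuation operator at scale `L^{-(N-k+1)}`. -/
def propagator (L N n : ℕ) (f : Lat L N → ℝ) : Lat L N → ℝ :=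
  fun x => ∑ k ∈ Finset.Icc 1 (N - n), (L : ℝ) ^ (2 * (k - 1)) * latFluct L N (N - k + 1) f x

/-- The second chaos component of the effective force at scale `n ≤ N`, on the unit lattice of side
length `Lⁿ`: the block average of the Wick product of the unit noise at scale `N` and its image
under the fluctuation propagator. -/
def secondChaos (ξ : Lp ℝ 2 torusMeasure → Ω → ℝ) (P : Measure Ω) (L N n : ℕ) (ω : Ω) :
    Lat L n → ℝ :=
  latAvg L N n fun y =>
    unitNoise ξ L N ω y * propagator L N n (unitNoise ξ L N ω) y -
      ∫ ω', unitNoise ξ L N ω' y * propagator L N n (unitNoise ξ L N ω') y ∂P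

/-- The norm of the enhanced noise, uniform in the cutoff `N`. -/
def noiseNorm (ξ : Lp ℝ 2 torusMeasure → Ω → ℝ) (P : Measure Ω) (L : ℕ) (κs : ℝ) (ω : Ω) :
    ℝ≥0∞ :=
  ⨆ (N : ℕ) (n : ℕ) (_ : n ≤ N) (x : Lat L n),
    ENNReal.ofReal ((L : ℝ) ^ (-κs * n) *
      max |unitNoise ξ L n ω x| (√|secondChaos ξ P L N n ω x|))

/-- The event that the norm of the enhanced noise is at most `1 / (2g)`. -/
def goodEvent (ξ : Lp ℝ 2 torusMeasure → Ω → ℝ) (P : Measure Ω) (L : ℕ) (κs g : ℝ) : Set Ω :=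
  {ω | noiseNorm ξ P L κs ω ≤ ENNReal.ofReal (1 / (2 * g))}

/-- The regularised hierarchical Anderson equation
`(-Δ_H) u = (g ξ_N + r - (1 - L⁻²) N g²) u + 1` on the lattice of spacing `L⁻ᴺ`. -/
def IsSolution (ξ : Lp ℝ 2 torusMeasure → Ω → ℝ) (L : ℕ) (r g : ℝ) (N : ℕ) (ω : Ω)
    (u : Lat L N → ℝ) : Prop :=
  ∀ x, negLaplacian L N u x =
    (g * latNoise ξ L N ω x + (r - (1 - ((L : ℝ) ^ 2)⁻¹) * N * g ^ 2)) * u x + 1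

end Noise

end HierAnderson

end

open HierAnderson

/-!
The hierarchical equation can be renormalised exactly. On a box of scale `n` consider its subboxes
of scale `n + 1`. The equation determines the solution on the subboxes from its mean over the box,
by multiplication with `(1 - v)⁻¹` divided by its block average, where `v = V / L²⁽ⁿ⁺¹⁾` is the
rescaled potential. The mean solves the same equation on the coarser lattice, with the effective
potential `L²⁽ⁿ⁺¹⁾ (1 - 1 / avg (1 - v)⁻¹)` and the same source `1`. Hence the solution is a
multiplicative cascade over the scales (`cascade`), started from `-1 / V₀`, where `V₀` is the
effective potential at scale zero. It solves the equation since the Laplacian telescopes along it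
(`IsPotential.negLaplacian_cascade`), and it is the only solution since averaging the equation over
boxes recovers the effective equations (`IsPotential.eq_cascade`).

To second order, the renormalisation step is the mean plus the variance over a block. So the
effective potential at scale `n` is `g Lⁿ ζₙ + r - (1 - L⁻²) n g² + g² Xₙ`, with the unit noise `ζₙ`
and the second chaos `Xₙ`, up to a remainder to which each scale `m > n` adds a cubic error of order
`(2 b³ / L)ᵐ`, `b = L ^ κs` (`IsRegular.effPot_approx`). The counterterm is exactly the mean of the
variance. On the good event and for large `L`, the potentials are therefore uniformly small on
positive scales, and `V₀ ≥ r - 3/4 - 1/8 > 0`. As the remainder at scale `m` tends to zero with `m`,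
uniformly in the cutoff, and as the flow to coarser scales is Lipschitz with a constant independent
of the number of scales, convergence of the second chaos at each scale implies convergence of the
effective potentials (`IsRegular.exists_tendsto_effPot`), hence of the cascades. The fluctuation of
the cascade at scale `n` is of order `n L⁻ⁿ`, as almost surely the noise grows at most linearly in
`n`; this gives convergence in every Hölder–Besov norm of exponent below one
(`memBesov_and_tendsto_of_potentials`).

The probabilistic input reduces to averages of the Wick squares `ζ² - 1` over boxes: the second
chaos is a sum of such averages over the scales (`chaos_eq_sum`), and the average over `ℓ²`
independent sites has exponential tails on the scale `1 / ℓ` (`measureReal_wick_avg_le`). Union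
bounds give the probability of the good event, and the Borel–Cantelli lemma gives the almost sure
convergence of the second chaos and the growth bound for the noise. White noise is additive over
subboxes only almost surely, so consistency of the noise on the different scales is one of the
properties that hold outside the exceptional null set.
-/

noncomputable section

namespace HierAnderson

/-! ### Boxes, cells and ancestors -/

section Geometry

variable {L : ℕ} [NeZero L]

/-- The label of the box of side `L⁻ⁿ` containing the point `z`. The value is only meaningful for
`z` in the torus; elsewhere it is a junk label. -/
def cell (L n : ℕ) [NeZero L] (z : Fin 2 → ℝ) : Lat L n :=
  fun i => Fin.ofNat (L ^ n) ⌊(z i + 1 / 2) * (L : ℝ) ^ n⌋₊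

/-- The label of the box of side `L⁻ⁿ` containing the lattice point `y` of spacing `L⁻ᴺ`, for
`n ≤ N`. -/
def anc (L N n : ℕ) [NeZero L] (y : Lat L N) : Lat L n := cell L n (pt L N y)

lemma L_pos : (0 : ℝ) < L := by exact_mod_cast Nat.pos_of_ne_zero (NeZero.ne L)

lemma mem_box_iff {n : ℕ} {x : Lat L n} {z : Fin 2 → ℝ} :
    z ∈ box L n x ↔ ∀ i, ((x i : ℕ) : ℝ) ≤ (z i + 1 / 2) * (L : ℝ) ^ n ∧
      (z i + 1 / 2) * (L : ℝ) ^ n < (x i : ℕ) + 1 := by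
  have hL : (0 : ℝ) < (L : ℝ) ^ n := pow_pos L_pos n
  simp only [box, mem_ofPred_eq, mem_Ico]
  refine forall_congr' fun i => ?_
  have e1 : pt L n x i - 1 / (2 * (L : ℝ) ^ n) = ((x i : ℕ) : ℝ) / (L : ℝ) ^ n - 1 / 2 := by
    simp only [pt]; field_simp; ring
  have e2 : pt L n x i + 1 / (2 * (L : ℝ) ^ n) = (((x i : ℕ) : ℝ) + 1) / (L : ℝ) ^ n - 1 / 2 := by
    simp only [pt]; field_simp; ring
  rw [e1, e2]
  refine and_congr ?_ ?_
  · rw [sub_le_iff_le_add, div_le_iff₀ hL]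
  · rw [lt_sub_iff_add_lt, lt_div_iff₀ hL]

lemma box_subset_torus {n : ℕ} (x : Lat L n) : box L n x ⊆ torus := by
  intro z hz i
  have hL : (0 : ℝ) < (L : ℝ) ^ n := pow_pos L_pos n
  obtain ⟨h1, h2⟩ := mem_box_iff.1 hz i
  have h3 : ((x i : ℕ) : ℝ) + 1 ≤ (L : ℝ) ^ n := by
    have := (x i).isLt
    exact_mod_cast this
  constructor
  · have : 0 ≤ (z i + 1 / 2) * (L : ℝ) ^ n := le_trans (Nat.cast_nonneg _) h1
    have := nonneg_of_mul_nonneg_left this hL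
    linarith
  · have : (z i + 1 / 2) * (L : ℝ) ^ n < 1 * (L : ℝ) ^ n := by linarith
    have := lt_of_mul_lt_mul_right this hL.le
    linarith

lemma mem_box_iff_cell {n : ℕ} {x : Lat L n} {z : Fin 2 → ℝ} (hz : z ∈ torus) :
    z ∈ box L n x ↔ cell L n z = x := by
  have hL : (0 : ℝ) < (L : ℝ) ^ n := pow_pos L_pos n
  rw [mem_box_iff, funext_iff]
  refine forall_congr' fun i => ?_
  have h0 : 0 ≤ (z i + 1 / 2) * (L : ℝ) ^ n := by
    have := (hz i).1; exact mul_nonneg (by linarith) hL.le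
  have h1 : ⌊(z i + 1 / 2) * (L : ℝ) ^ n⌋₊ < L ^ n := by
    rw [Nat.floor_lt h0]
    push_cast
    have := (hz i).2
    nlinarith
  rw [Fin.ext_iff]
  simp only [cell, Fin.val_ofNat, Nat.mod_eq_of_lt h1]
  rw [Nat.floor_eq_iff h0]

lemma mem_box_cell {n : ℕ} {z : Fin 2 → ℝ} (hz : z ∈ torus) : z ∈ box L n (cell L n z) :=
  (mem_box_iff_cell hz).2 rfl

lemma pt_mem_box {n : ℕ} (x : Lat L n) : pt L n x ∈ box L n x := by
  have hL : (0 : ℝ) < (L : ℝ) ^ n := pow_pos L_pos n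
  intro i
  have : 0 < 1 / (2 * (L : ℝ) ^ n) := by positivity
  constructor <;> linarith

lemma pt_mem_torus {n : ℕ} (x : Lat L n) : pt L n x ∈ torus := box_subset_torus x (pt_mem_box x)

lemma cell_pt {n : ℕ} (x : Lat L n) : cell L n (pt L n x) = x :=
  (mem_box_iff_cell (pt_mem_torus x)).1 (pt_mem_box x)

lemma pt_mem_box_iff {N n : ℕ} {y : Lat L N} {x : Lat L n} :
    pt L N y ∈ box L n x ↔ anc L N n y = x :=
  mem_box_iff_cell (pt_mem_torus y)

/-- Boxes are nested: a box meeting the coarser box in its centre is contained in it. -/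
lemma box_subset_box_anc {N n : ℕ} (h : n ≤ N) (y : Lat L N) :
    box L N y ⊆ box L n (anc L N n y) := by
  intro z hz
  have hp : pt L N y ∈ box L n (anc L N n y) := pt_mem_box_iff.2 rfl
  rw [mem_box_iff] at hz hp ⊢
  intro i
  obtain ⟨d, hN⟩ := Nat.exists_eq_add_of_le h
  have hNd : (L : ℝ) ^ N = (L : ℝ) ^ n * (L : ℝ) ^ d := by rw [hN, pow_add]
  set x := anc L N n y
  have hL : (0 : ℝ) < (L : ℝ) ^ n := pow_pos L_pos n
  have hd : (0 : ℝ) < (L : ℝ) ^ d := pow_pos L_pos d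
  obtain ⟨a1, a2⟩ := hp i
  obtain ⟨b1, b2⟩ := hz i
  have e : (pt L N y i + 1 / 2) * (L : ℝ) ^ n = (((y i : ℕ) : ℝ) + 1 / 2) / (L : ℝ) ^ d := by
    simp only [pt, hNd]; field_simp; ring
  rw [e, le_div_iff₀ hd] at a1
  rw [e, div_lt_iff₀ hd] at a2
  have c1 : (x i : ℕ) * L ^ d ≤ (y i : ℕ) := by
    have : (((x i : ℕ) * L ^ d : ℕ) : ℝ) < (((y i : ℕ) + 1 : ℕ) : ℝ) := by push_cast; linarith
    have := Nat.cast_lt.1 this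
    omega
  have c2 : (y i : ℕ) + 1 ≤ ((x i : ℕ) + 1) * L ^ d := by
    have : (((y i : ℕ)  : ℕ) : ℝ) < ((((x i : ℕ) + 1) * L ^ d : ℕ) : ℝ) := by push_cast; linarith
    have := Nat.cast_lt.1 this
    omega
  have c1' : ((x i : ℕ) : ℝ) * (L : ℝ) ^ d ≤ (y i : ℕ) := by exact_mod_cast c1
  have c2' : ((y i : ℕ) : ℝ) + 1 ≤ ((x i : ℕ) + 1) * (L : ℝ) ^ d := by exact_mod_cast c2
  rw [hNd, ← mul_assoc] at b1 b2
  exact ⟨le_of_mul_le_mul_right (c1'.trans b1) hd, lt_of_mul_lt_mul_right (b2.trans_le c2') hd.le⟩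

lemma anc_cell {N n : ℕ} (h : n ≤ N) {z : Fin 2 → ℝ} (hz : z ∈ torus) :
    anc L N n (cell L N z) = cell L n z :=
  ((mem_box_iff_cell hz).1 (box_subset_box_anc h _ (mem_box_cell hz))).symm

lemma anc_anc {N m n : ℕ} (h : n ≤ m) (y : Lat L N) :
    anc L m n (anc L N m y) = anc L N n y :=
  anc_cell h (pt_mem_torus y)

lemma anc_self {n : ℕ} (x : Lat L n) : anc L n n x = x := cell_pt x

lemma step_apply {n : ℕ} (f : Lat L n → ℝ) {z : Fin 2 → ℝ} (hz : z ∈ torus) :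
    step L n f z = f (cell L n z) := by
  classical
  rw [step, Finset.sum_eq_single (cell L n z)]
  · rw [indicator_of_mem (mem_box_cell hz)]
  · intro x _ hx
    rw [indicator_of_notMem]
    rw [mem_box_iff_cell hz]
    exact fun h => hx h.symm
  · simp

lemma step_pt {N n : ℕ} (f : Lat L n → ℝ) (y : Lat L N) :
    step L n f (pt L N y) = f (anc L N n y) := step_apply f (pt_mem_torus y)

open scoped Classical in
/-- The indicator of a box is the sum of the indicators of the smaller boxes it contains. -/
lemma indicator_box_eq_sum {N n : ℕ} (h : n ≤ N) (x : Lat L n) (c : ℝ) (z : Fin 2 → ℝ) :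
    (box L n x).indicator (fun _ => c) z =
      ∑ y : Lat L N with pt L N y ∈ box L n x, (box L N y).indicator (fun _ => c) z := by
  by_cases hz : z ∈ torus
  · have : ∀ y : Lat L N, (box L N y).indicator (fun _ => c) z
        = if y = cell L N z then c else 0 := by
      intro y
      simp only [indicator_apply, mem_box_iff_cell hz, eq_comm]
    simp only [this, Finset.sum_ite_eq', Finset.mem_filter, Finset.mem_univ, true_and,
      pt_mem_box_iff, anc_cell h hz, indicator_apply, mem_box_iff_cell hz]
  · rw [indicator_of_notMem fun hx => hz (box_subset_torus x hx), Finset.sum_eq_zero]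
    intro y _
    rw [indicator_of_notMem fun hx => hz (box_subset_torus y hx)]

lemma volume_box {n : ℕ} (x : Lat L n) :
    volume (box L n x) = ENNReal.ofReal (((L : ℝ) ^ (2 * n))⁻¹) := by
  have hL : (0 : ℝ) < (L : ℝ) ^ n := pow_pos L_pos n
  have h : box L n x = Set.pi univ (fun i =>
      Ico (pt L n x i - 1 / (2 * (L : ℝ) ^ n)) (pt L n x i + 1 / (2 * (L : ℝ) ^ n))) := by
    ext y; simp only [box, mem_ofPred_eq, mem_univ_pi]
  rw [h, volume_pi_pi]
  simp only [Real.volume_Ico, Fin.prod_univ_two]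
  rw [← ENNReal.ofReal_mul (by ring_nf; positivity)]
  congr 1
  rw [pow_mul']
  field_simp
  ring

lemma volume_real_box {n : ℕ} (x : Lat L n) :
    volume.real (box L n x) = ((L : ℝ) ^ (2 * n))⁻¹ := by
  rw [measureReal_def, volume_box, ENNReal.toReal_ofReal]
  have := L_pos (L := L)
  positivity

lemma torusMeasure_box {n : ℕ} (x : Lat L n) : torusMeasure (box L n x) = volume (box L n x) := by
  rw [torusMeasure, Measure.restrict_apply (measurableSet_box L n x),
    inter_eq_left.2 (box_subset_torus x)]

lemma box_zero (x : Lat L 0) : box L 0 x = torus := by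
  refine (box_subset_torus x).antisymm fun z hz => ?_
  rw [mem_box_iff_cell hz]
  exact Subsingleton.elim (α := Fin 2 → Fin (L ^ 0)) (h := by rw [pow_zero]; infer_instance) _ _

lemma setIntegral_const_box {n : ℕ} (x : Lat L n) (c : ℝ) :
    ∫ _ in box L n x, c = ((L : ℝ) ^ (2 * n))⁻¹ * c := by
  rw [setIntegral_const, volume_real_box, smul_eq_mul]

open scoped Classical in
lemma card_children {N n : ℕ} (h : n ≤ N) (x : Lat L n) :
    (((Finset.univ.filter fun y : Lat L N => pt L N y ∈ box L n x).card : ℕ) : ℝ)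
      = (L : ℝ) ^ (2 * (N - n)) := by
  have hL := L_pos (L := L)
  have h1 : ∫ z, (box L n x).indicator (fun _ => (1 : ℝ)) z = ((L : ℝ) ^ (2 * n))⁻¹ := by
    rw [integral_indicator (measurableSet_box L n x), setIntegral_const_box, mul_one]
  have h2 : ∫ z, (box L n x).indicator (fun _ => (1 : ℝ)) z
      = ((Finset.univ.filter fun y : Lat L N => pt L N y ∈ box L n x).card : ℝ)
        * ((L : ℝ) ^ (2 * N))⁻¹ := by
    simp_rw [indicator_box_eq_sum h x (1 : ℝ)]
    rw [integral_finsetSum]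
    · simp_rw [integral_indicator (measurableSet_box L N _), setIntegral_const_box]
      simp
    · intro y _
      rw [integrable_indicator_iff (measurableSet_box L N y)]
      exact integrableOn_const (by rw [volume_box]; exact ENNReal.ofReal_ne_top)
  rw [h1] at h2
  have e : (L : ℝ) ^ (2 * N) = (L : ℝ) ^ (2 * n) * (L : ℝ) ^ (2 * (N - n)) := by
    rw [← pow_add]; congr 1; omega
  rw [e] at h2
  field_simp at h2
  linarith

end Geometry

/-! ### Block averages -/

section Average

variable {L N n : ℕ}

lemma latAvg_add (f h : Lat L N → ℝ) (x : Lat L n) :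
    latAvg L N n (fun y => f y + h y) x = latAvg L N n f x + latAvg L N n h x := by
  simp only [latAvg, Finset.sum_add_distrib, mul_add]

lemma latAvg_const_mul (c : ℝ) (f : Lat L N → ℝ) (x : Lat L n) :
    latAvg L N n (fun y => c * f y) x = c * latAvg L N n f x := by
  simp only [latAvg, ← Finset.mul_sum]; ring

/-- The block average over the box of `x`, as a linear functional. -/
def latAvgLin (L N n : ℕ) (x : Lat L n) : (Lat L N → ℝ) →ₗ[ℝ] ℝ where
  toFun f := latAvg L N n f x
  map_add' f h := latAvg_add f h x
  map_smul' c f := latAvg_const_mul c f x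

lemma latAvg_sum {ι : Type*} (s : Finset ι) (f : ι → Lat L N → ℝ) (x : Lat L n) :
    latAvg L N n (fun y => ∑ i ∈ s, f i y) x = ∑ i ∈ s, latAvg L N n (f i) x := by
  have := map_sum (latAvgLin L N n x) f s
  rw [show (fun y => ∑ i ∈ s, f i y) = ∑ i ∈ s, f i by ext; simp]
  exact this

lemma latAvg_sub (f h : Lat L N → ℝ) (x : Lat L n) :
    latAvg L N n (fun y => f y - h y) x = latAvg L N n f x - latAvg L N n h x :=
  map_sub (latAvgLin L N n x) f h

variable [NeZero L]

lemma latAvg_eq (f : Lat L N → ℝ) (x : Lat L n) :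
    latAvg L N n f x = ((L : ℝ) ^ (2 * (N - n)))⁻¹ *
      ∑ y : Lat L N with anc L N n y = x, f y := by
  classical
  rw [latAvg]
  simp only [pt_mem_box_iff]

lemma latAvg_congr {f h : Lat L N → ℝ} {x : Lat L n}
    (H : ∀ y, anc L N n y = x → f y = h y) : latAvg L N n f x = latAvg L N n h x := by
  rw [latAvg_eq, latAvg_eq]
  congr 1
  refine Finset.sum_congr rfl fun y hy => H y (by simpa using hy)

lemma latAvg_const (hn : n ≤ N) (c : ℝ) (x : Lat L n) : latAvg L N n (fun _ => c) x = c := by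
  have hL := L_pos (L := L)
  rw [latAvg, Finset.sum_const, nsmul_eq_mul, card_children hn]
  field_simp

lemma latAvg_nonneg {f : Lat L N → ℝ} (hf : ∀ y, 0 ≤ f y) (x : Lat L n) :
    0 ≤ latAvg L N n f x := by
  have hL := L_pos (L := L)
  exact mul_nonneg (by positivity) (Finset.sum_nonneg fun y _ => hf y)

lemma latAvg_self (f : Lat L N → ℝ) : latAvg L N N f = f := by
  funext x
  rw [latAvg_eq]
  simp only [anc_self, Finset.filter_eq', Finset.mem_univ, if_true, Finset.sum_singleton]
  simp

lemma latAvg_latAvg {m : ℕ} (h1 : n ≤ m) (h2 : m ≤ N) (f : Lat L N → ℝ) (x : Lat L n) :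
    latAvg L m n (latAvg L N m f) x = latAvg L N n f x := by
  have hL := L_pos (L := L)
  simp only [latAvg_eq]
  rw [← Finset.mul_sum, ← mul_assoc, ← mul_inv, ← pow_add]
  congr 1
  · congr 2
    omega
  · rw [← Finset.sum_fiberwise_of_maps_to (s := Finset.univ.filter fun y => anc L N n y = x)
      (t := Finset.univ.filter fun y => anc L m n y = x) (g := anc L N m)]
    · refine Finset.sum_congr rfl fun z hz => ?_
      refine Finset.sum_congr ?_ fun _ _ => rfl
      ext y
      simp only [Finset.mem_filter, Finset.mem_univ, true_and] at hz ⊢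
      constructor
      · rintro rfl
        exact ⟨by rw [← anc_anc h1, hz], rfl⟩
      · exact fun h => h.2
    · intro y hy
      simp only [Finset.mem_filter, Finset.mem_univ, true_and] at hy ⊢
      rw [anc_anc h1, hy]

/-- Functions of the coarse variable can be pulled out of a block average. -/
lemma latAvg_anc_mul (h : Lat L n → ℝ) (f : Lat L N → ℝ) (x : Lat L n) :
    latAvg L N n (fun y => h (anc L N n y) * f y) x = h x * latAvg L N n f x := by
  rw [← latAvg_const_mul]
  exact latAvg_congr fun y hy => by rw [hy]

lemma latFluct_apply (f : Lat L N → ℝ) (x : Lat L N) :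
    latFluct L N n f x =
      latAvg L N n f (anc L N n x) - latAvg L N (n - 1) f (anc L N (n - 1) x) := by
  rw [latFluct, step_pt, step_pt]

end Average

/-! ### One renormalisation step for an abstract mean -/

section Mean

variable {ι : Type*} {A : (ι → ℝ) →ₗ[ℝ] ℝ}

/-- A mean: a positive normalised linear functional on functions on `ι`. -/
structure IsMean (A : (ι → ℝ) →ₗ[ℝ] ℝ) : Prop where
  nonneg : ∀ f, (∀ i, 0 ≤ f i) → 0 ≤ A f
  one : A (fun _ => 1) = 1

namespace IsMean

variable (hA : IsMean A)
include hA

lemma const (c : ℝ) : A (fun _ => c) = c := by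
  have : (fun _ : ι => c) = c • fun _ : ι => (1 : ℝ) := by ext; simp
  rw [this, map_smul, hA.one, smul_eq_mul, mul_one]

lemma mono {f h : ι → ℝ} (H : ∀ i, f i ≤ h i) : A f ≤ A h := by
  have := hA.nonneg (h - f) fun i => by simpa using H i
  rw [map_sub] at this
  linarith

lemma le_of_le {f : ι → ℝ} {c : ℝ} (H : ∀ i, f i ≤ c) : A f ≤ c := by
  have := hA.mono (h := fun _ => c) H
  rwa [hA.const] at this

lemma ge_of_ge {f : ι → ℝ} {c : ℝ} (H : ∀ i, c ≤ f i) : c ≤ A f := by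
  have := hA.mono (f := fun _ => c) H
  rwa [hA.const] at this

lemma abs_apply_le {f : ι → ℝ} {c : ℝ} (H : ∀ i, |f i| ≤ c) : |A f| ≤ c :=
  abs_le.2 ⟨hA.ge_of_ge fun i => (abs_le.1 (H i)).1,
    hA.le_of_le fun i => (abs_le.1 (H i)).2⟩

lemma abs_apply_sub_le {f h : ι → ℝ} {c : ℝ} (H : ∀ i, |f i - h i| ≤ c) : |A f - A h| ≤ c := by
  rw [← map_sub]
  exact hA.abs_apply_le H

end IsMean

lemma inv_one_sub_bounds {s x : ℝ} (hs : s ≤ 1 / 10) (hx : |x| ≤ s) :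
    (1 + s)⁻¹ ≤ (1 - x)⁻¹ ∧ (1 - x)⁻¹ ≤ (1 - s)⁻¹ := by
  obtain ⟨h1, h2⟩ := abs_le.1 hx
  constructor
  · exact inv_anti₀ (by linarith) (by linarith)
  · exact inv_anti₀ (by linarith) (by linarith)

lemma mean_inv_bounds (hA : IsMean A) {s : ℝ} (hs : s ≤ 1 / 10) {v : ι → ℝ}
    (hv : ∀ i, |v i| ≤ s) :
    (1 + s)⁻¹ ≤ A (fun i => (1 - v i)⁻¹) ∧ A (fun i => (1 - v i)⁻¹) ≤ (1 - s)⁻¹ :=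
  ⟨hA.ge_of_ge fun i => (inv_one_sub_bounds hs (hv i)).1,
    hA.le_of_le fun i => (inv_one_sub_bounds hs (hv i)).2⟩

lemma mean_inv_pos (hA : IsMean A) {s : ℝ} (hs0 : 0 ≤ s) (hs : s ≤ 1 / 10) {v : ι → ℝ}
    (hv : ∀ i, |v i| ≤ s) : 0 < A (fun i => (1 - v i)⁻¹) :=
  lt_of_lt_of_le (by positivity) (mean_inv_bounds hA hs hv).1

lemma abs_le_mul_of_abs {x y a b : ℝ} (hx : |x| ≤ a) (hy : |y| ≤ b) : |x * y| ≤ a * b := by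
  rw [abs_mul]
  exact mul_le_mul hx hy (abs_nonneg _) ((abs_nonneg _).trans hx)

/-- Third order expansion of the renormalisation step: up to a cubic error, the effective
potential is the mean plus the variance; in the variance the potential `v` may be replaced by its
main part `α`. -/
lemma abs_rgStep_expansion (hA : IsMean A) {s β : ℝ} (hs0 : 0 ≤ s) (hs : s ≤ 1 / 10)
    {v α : ι → ℝ} (hv : ∀ i, |v i| ≤ s) (hα : ∀ i, |α i| ≤ s) (hβ : ∀ i, |v i - α i| ≤ β) :
    |1 - (A fun i => (1 - v i)⁻¹)⁻¹ - (A v + A (fun i => α i ^ 2) - A α ^ 2)|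
      ≤ 7 * s ^ 3 + 4 * s * β := by
  have hs2 : s ^ 2 ≤ s / 10 := by nlinarith
  have hs3 : s ^ 3 ≤ s ^ 2 / 10 := by nlinarith [sq_nonneg s]
  set T := A (fun i => (1 - v i)⁻¹) - 1 with hT
  set m1 := A v with hm1
  set m2 := A (fun i => v i ^ 2) with hm2
  have hm1s : |m1| ≤ s := hA.abs_apply_le hv
  have hm2s : |m2| ≤ s ^ 2 := hA.abs_apply_le fun i => by
    rw [abs_pow]; exact pow_le_pow_left₀ (abs_nonneg _) (hv i) 2
  have hE : |T - m1 - m2| ≤ 2 * s ^ 3 := by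
    have e : T - m1 - m2 = A (fun i => (1 - v i)⁻¹ - 1 - v i - v i ^ 2) := by
      have : (fun i => (1 - v i)⁻¹ - 1 - v i - v i ^ 2)
        = (fun i => (1 - v i)⁻¹) - (fun _ => (1 : ℝ)) - v - (fun i => v i ^ 2) := by
        ext; simp
      rw [this, map_sub, map_sub, map_sub, hA.one]
    rw [e]
    refine hA.abs_apply_le fun i => ?_
    obtain ⟨h1, h2⟩ := abs_le.1 (hv i)
    have h3 : 0 < 1 - v i := by linarith
    have : (1 - v i)⁻¹ - 1 - v i - v i ^ 2 = v i ^ 3 * (1 - v i)⁻¹ := by field_simp; ring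
    rw [this, mul_comm 2]
    refine abs_le_mul_of_abs ?_ ?_
    · rw [abs_pow]; exact pow_le_pow_left₀ (abs_nonneg _) (hv i) 3
    · rw [abs_of_pos (by positivity)]
      rw [inv_le_comm₀ h3 (by norm_num)]
      linarith
  have hT1 : |T - m1| ≤ 12 / 10 * s ^ 2 := by
    have : T - m1 = (T - m1 - m2) + m2 := by ring
    rw [this]
    refine (abs_add_le _ _).trans ?_
    linarith
  have hT2 : |T| ≤ 12 / 10 * s := by
    have : T = (T - m1) + m1 := by ring
    rw [this]
    refine (abs_add_le _ _).trans ?_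
    linarith
  have hT3 : |T + m1| ≤ 22 / 10 * s := (abs_add_le _ _).trans (by linarith)
  have hTpos : 88 / 100 ≤ 1 + T := by
    have := (abs_le.1 hT2).1
    linarith
  have e0 : A (fun i => (1 - v i)⁻¹) = 1 + T := by rw [hT]; ring
  have e1 : 1 - (1 + T)⁻¹ - (m1 + A (fun i => α i ^ 2) - A α ^ 2)
      = T ^ 3 * (1 + T)⁻¹ + (T - m1 - m2) - (T - m1) * (T + m1)
        + (m2 - A (fun i => α i ^ 2)) - (m1 - A α) * (m1 + A α) := by
    have : 1 + T ≠ 0 := by linarith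
    field_simp
    ring
  rw [e0, e1]
  have b1 : |T ^ 3 * (1 + T)⁻¹| ≤ (12 / 10 * s) ^ 3 * (100 / 88) := by
    refine abs_le_mul_of_abs ?_ ?_
    · rw [abs_pow]; exact pow_le_pow_left₀ (abs_nonneg _) hT2 3
    · rw [abs_of_pos (by positivity), inv_le_comm₀ (by linarith) (by norm_num)]
      linarith
  have b2 := abs_le_mul_of_abs hT1 hT3
  have b3 : |m2 - A (fun i => α i ^ 2)| ≤ 2 * s * β := by
    refine hA.abs_apply_sub_le fun i => ?_
    have : v i ^ 2 - α i ^ 2 = (v i + α i) * (v i - α i) := by ring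
    rw [this]
    refine abs_le_mul_of_abs ((abs_add_le _ _).trans ?_) (hβ i)
    linarith [hv i, hα i]
  have b4 : |(m1 - A α) * (m1 + A α)| ≤ β * (2 * s) := by
    refine abs_le_mul_of_abs (hA.abs_apply_sub_le hβ) ((abs_add_le _ _).trans ?_)
    linarith [hA.abs_apply_le hα]
  refine (abs_sub _ _).trans ?_
  refine (add_le_add_left (abs_add_le _ _) _).trans ?_
  refine (add_le_add_left (add_le_add_left (abs_sub _ _) _) _).trans ?_
  refine (add_le_add_left (add_le_add_left (add_le_add_left (abs_add_le _ _) _) _) _).trans ?_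
  have : 0 ≤ s ^ 3 := by positivity
  nlinarith

/-- In rescaled variables, the renormalisation step expands distances at most by `1 + 8 s`. -/
lemma abs_rgStep_sub_le (hA : IsMean A) {s δ : ℝ} (hs0 : 0 ≤ s) (hs : s ≤ 1 / 10)
    {v w : ι → ℝ} (hv : ∀ i, |v i| ≤ s) (hw : ∀ i, |w i| ≤ s) (hδ : ∀ i, |v i - w i| ≤ δ)
    (hδ0 : 0 ≤ δ) :
    |(1 - (A fun i => (1 - v i)⁻¹)⁻¹) - (1 - (A fun i => (1 - w i)⁻¹)⁻¹)| ≤ (1 + 8 * s) * δ := by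
  have pv := mean_inv_pos hA hs0 hs hv
  have pw := mean_inv_pos hA hs0 hs hw
  obtain ⟨bv, -⟩ := mean_inv_bounds hA hs hv
  obtain ⟨bw, -⟩ := mean_inv_bounds hA hs hw
  have hd : |A (fun i => (1 - v i)⁻¹) - A (fun i => (1 - w i)⁻¹)|
      ≤ δ * ((1 - s)⁻¹ * (1 - s)⁻¹) := by
    refine hA.abs_apply_sub_le fun i => ?_
    obtain ⟨v1, v2⟩ := abs_le.1 (hv i)
    obtain ⟨w1, w2⟩ := abs_le.1 (hw i)
    have h1 : 0 < 1 - v i := by linarith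
    have h2 : 0 < 1 - w i := by linarith
    have e : (1 - v i)⁻¹ - (1 - w i)⁻¹ = (v i - w i) * ((1 - v i)⁻¹ * (1 - w i)⁻¹) := by
      field_simp; ring
    rw [e]
    refine abs_le_mul_of_abs (hδ i) (abs_le_mul_of_abs ?_ ?_)
    · rw [abs_of_pos (by positivity)]; exact (inv_one_sub_bounds hs (hv i)).2
    · rw [abs_of_pos (by positivity)]; exact (inv_one_sub_bounds hs (hw i)).2
  set a := A (fun i => (1 - v i)⁻¹)
  set b := A (fun i => (1 - w i)⁻¹)
  have e : (1 - a⁻¹) - (1 - b⁻¹) = (a - b) * (a⁻¹ * b⁻¹) := by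
    field_simp; ring
  have ha : |a⁻¹| ≤ 1 + s := by
    rw [abs_of_pos (by positivity)]; exact inv_le_of_inv_le₀ (by linarith) bv
  have hb : |b⁻¹| ≤ 1 + s := by
    rw [abs_of_pos (by positivity)]; exact inv_le_of_inv_le₀ (by linarith) bw
  rw [e]
  refine (abs_le_mul_of_abs hd (abs_le_mul_of_abs ha hb)).trans ?_
  have h1s : 0 < 1 - s := by linarith
  have : (1 - s)⁻¹ * (1 - s)⁻¹ * ((1 + s) * (1 + s)) ≤ 1 + 8 * s := by
    have e : (1 - s)⁻¹ * (1 - s)⁻¹ * ((1 + s) * (1 + s)) = (1 + s) ^ 2 / (1 - s) ^ 2 := by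
      field_simp
    rw [e, div_le_iff₀ (by positivity)]
    nlinarith [mul_nonneg hs0 hs0, mul_nonneg hs0 (mul_nonneg hs0 hs0)]
  nlinarith

/-- The multiplicative increments of the solution are close to one. -/
lemma abs_inv_div_mean_sub_one_le (hA : IsMean A) {s : ℝ} (hs0 : 0 ≤ s) (hs : s ≤ 1 / 10)
    {v : ι → ℝ} (hv : ∀ i, |v i| ≤ s) (i : ι) :
    |(1 - v i)⁻¹ / A (fun i => (1 - v i)⁻¹) - 1| ≤ 4 * s := by
  have pv := mean_inv_pos hA hs0 hs hv
  obtain ⟨b1, b2⟩ := mean_inv_bounds hA hs hv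
  obtain ⟨c1, c2⟩ := inv_one_sub_bounds hs (hv i)
  set a := A (fun i => (1 - v i)⁻¹)
  have h1s : 0 < 1 - s := by linarith
  have k1 : (1 - s)⁻¹ ≤ (1 + 4 * s) * (1 + s)⁻¹ := by
    rw [inv_eq_one_div, ← div_eq_mul_inv, div_le_div_iff₀ h1s (by linarith)]
    nlinarith
  have k2 : (1 - 4 * s) * (1 - s)⁻¹ ≤ (1 + s)⁻¹ := by
    rw [inv_eq_one_div (1 + s), ← div_eq_mul_inv, div_le_div_iff₀ h1s (by linarith)]
    nlinarith
  rw [abs_le]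
  constructor
  · rw [neg_le_sub_iff_le_add, ← sub_le_iff_le_add, le_div_iff₀ pv]
    nlinarith
  · rw [sub_le_iff_le_add, div_le_iff₀ pv]
    nlinarith

end Mean

/-! ### The renormalisation flow of the potential -/

section Flow

variable {L : ℕ}

/-- One renormalisation step: integrating out the fluctuations at scale `n + 1` turns the potential
`V` on the lattice of spacing `L⁻⁽ⁿ⁺¹⁾` into an effective potential on the next coarser lattice. -/
def rgStep (L n : ℕ) (V : Lat L (n + 1) → ℝ) : Lat L n → ℝ := fun x =>
  (L : ℝ) ^ (2 * (n + 1)) *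
    (1 - (latAvg L (n + 1) n (fun y => (1 - V y / (L : ℝ) ^ (2 * (n + 1)))⁻¹) x)⁻¹)

/-- The second chaos at scale `n` for the cutoff `n + k`, through its recursion in the scale, as a
function of the unit noises `ζ` on all scales. -/
def chaos (L : ℕ) (ζ : ∀ n, Lat L n → ℝ) : ℕ → ∀ n, Lat L n → ℝ
  | 0, _, _ => 0
  | k + 1, n, x => latAvg L (n + 1) n (chaos L ζ k (n + 1)) x +
      (latAvg L (n + 1) n (fun y => ζ (n + 1) y ^ 2) x - ζ n x ^ 2 / (L : ℝ) ^ 2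
        - (1 - ((L : ℝ) ^ 2)⁻¹))

/-- The effective potential at scale `n` for the cutoff `n + k`. -/
def effPot (L : ℕ) (r g : ℝ) (ζ : ∀ n, Lat L n → ℝ) : ℕ → ∀ n, Lat L n → ℝ
  | 0, n, x => g * ((L : ℝ) ^ n * ζ n x) + (r - (1 - ((L : ℝ) ^ 2)⁻¹) * n * g ^ 2)
  | k + 1, n, x => rgStep L n (effPot L r g ζ k (n + 1)) x

/-- The effective potential up to second order in the noise. -/
def effPotMain (L : ℕ) (r g : ℝ) (ζ : ∀ n, Lat L n → ℝ) (k n : ℕ) (x : Lat L n) : ℝ :=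
  g * ((L : ℝ) ^ n * ζ n x) + (r - (1 - ((L : ℝ) ^ 2)⁻¹) * n * g ^ 2) + g ^ 2 * chaos L ζ k n x

/-- The ratio `2 b³ / L`, whose powers bound the remainder of the effective potential. -/
def decayRate (L : ℕ) (b : ℝ) : ℝ := 2 * b ^ 3 / L

/-- The properties of a realisation of the noise that control the renormalisation flow; `b` stands
for `L ^ κs`. -/
structure IsRegular (L : ℕ) (r g b : ℝ) (ζ : ∀ n, Lat L n → ℝ) : Prop where
  one_le_r : 1 ≤ r
  g_pos : 0 < g
  g_le_one : g ≤ 1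
  one_le_b : 1 ≤ b
  le_L : 2000 * r * b ^ 3 ≤ L
  consistent : ∀ n x, latAvg L (n + 1) n (ζ (n + 1)) x = ζ n x / L
  noise_le : ∀ n x, |g * ζ n x| ≤ b ^ n / 2
  chaos_le : ∀ k n x, |g ^ 2 * chaos L ζ k n x| ≤ b ^ (2 * n) / 4

lemma isMean_latAvgLin [NeZero L] {N n : ℕ} (h : n ≤ N) (x : Lat L n) :
    IsMean (latAvgLin L N n x) :=
  ⟨fun _ hf => latAvg_nonneg hf x, latAvg_const h 1 x⟩

namespace IsRegular

variable {r g b : ℝ} {ζ : ∀ n, Lat L n → ℝ}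

section
variable (h : IsRegular L r g b ζ)
include h

lemma L_pos : (0 : ℝ) < L := by
  have h1 := h.one_le_r
  have h2 : 1 ≤ b ^ 3 := one_le_pow₀ h.one_le_b
  have := h.le_L
  nlinarith

lemma decayRate_pos : 0 < decayRate L b := by
  have := h.L_pos
  have := h.one_le_b
  unfold decayRate; positivity

lemma r_mul_decayRate : r * decayRate L b ≤ 1 / 1000 := by
  have hL := h.L_pos
  have := h.le_L
  unfold decayRate
  rw [← mul_div_assoc, div_le_div_iff₀ hL (by norm_num)]
  linarith

lemma decayRate_le : decayRate L b ≤ 1 / 1000 := by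
  nlinarith [h.r_mul_decayRate, h.decayRate_pos, h.one_le_r]

lemma two_mul_div_le : 2 * (b / L) ≤ decayRate L b := by
  have hL := h.L_pos
  have hb := h.one_le_b
  unfold decayRate
  rw [← mul_div_assoc]
  refine div_le_div_of_nonneg_right ?_ hL.le
  nlinarith [mul_nonneg (sub_nonneg.2 hb) (sub_nonneg.2 hb)]

lemma div_pos : 0 < b / L := by
  have := h.L_pos
  have := h.one_le_b
  positivity

lemma div_le : b / L ≤ 1 / 2000 := by linarith [h.two_mul_div_le, h.decayRate_le]

lemma div_pow_le {n : ℕ} (hn : 1 ≤ n) : (b / L) ^ n ≤ 1 / 2000 :=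
  (pow_le_of_le_one h.div_pos.le (by linarith [h.div_le]) (by omega)).trans h.div_le

/-- A potential with the expected second order expansion is small, and to leading order it is the
noise. -/
lemma small_of_approx {k n : ℕ} {x : Lat L n} {V : ℝ}
    (hV : |V - effPotMain L r g ζ k n x| ≤ 38 * r * decayRate L b ^ (n + 1)) :
    |V / (L : ℝ) ^ (2 * n) - g * ζ n x / (L : ℝ) ^ n|
        ≤ 3 * r * (2 * b ^ 2) ^ n / (L : ℝ) ^ (2 * n) ∧
      |g * ζ n x / (L : ℝ) ^ n| ≤ (b / L) ^ n / 2 := by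
  have hL := h.L_pos
  have hb := h.one_le_b
  have hr := h.one_le_r
  have hLn : (0 : ℝ) < (L : ℝ) ^ n := by positivity
  constructor
  · have e : V / (L : ℝ) ^ (2 * n) - g * ζ n x / (L : ℝ) ^ n
        = (V - g * ((L : ℝ) ^ n * ζ n x)) / (L : ℝ) ^ (2 * n) := by
      rw [pow_mul']; field_simp
    rw [e, abs_div, abs_of_pos (by positivity : (0 : ℝ) < (L : ℝ) ^ (2 * n))]
    refine div_le_div_of_nonneg_right ?_ (by positivity)
    have e2 : V - g * ((L : ℝ) ^ n * ζ n x) = (V - effPotMain L r g ζ k n x)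
        + (r - (1 - ((L : ℝ) ^ 2)⁻¹) * n * g ^ 2) + g ^ 2 * chaos L ζ k n x := by
      rw [effPotMain]; ring
    rw [e2]
    have b1 : |V - effPotMain L r g ζ k n x| ≤ 1 := by
      refine hV.trans ?_
      have : decayRate L b ^ (n + 1) ≤ decayRate L b :=
        pow_le_of_le_one h.decayRate_pos.le (by linarith [h.decayRate_le]) (by omega)
      nlinarith [h.r_mul_decayRate]
    have b2 : |r - (1 - ((L : ℝ) ^ 2)⁻¹) * n * g ^ 2| ≤ r + n := by
      have c0 : 0 ≤ 1 - ((L : ℝ) ^ 2)⁻¹ := by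
        have : 1 ≤ (L : ℝ) := by
          have : 1 ≤ b ^ 3 := one_le_pow₀ hb
          have := h.le_L
          nlinarith
        rw [sub_nonneg]
        exact inv_le_one_of_one_le₀ (one_le_pow₀ this)
      have c1 : 1 - ((L : ℝ) ^ 2)⁻¹ ≤ 1 := by
        rw [sub_le_self_iff]; positivity
      have g2 : g ^ 2 ≤ 1 := pow_le_one₀ h.g_pos.le h.g_le_one
      have n0 : (0 : ℝ) ≤ n := Nat.cast_nonneg n
      have t1 : (1 - ((L : ℝ) ^ 2)⁻¹) * n * g ^ 2 ≤ 1 * n * 1 := by gcongr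
      have t0 : 0 ≤ (1 - ((L : ℝ) ^ 2)⁻¹) * n * g ^ 2 := by positivity
      rw [abs_le]; constructor <;> linarith
    have b3 := h.chaos_le k n x
    refine (abs_add_le _ _).trans ((add_le_add_left (abs_add_le _ _) _).trans ?_)
    have n1 : (n : ℝ) + 1 ≤ 2 ^ n := by
      have := Nat.lt_two_pow_self (n := n)
      exact_mod_cast this
    have n2 : (1 : ℝ) ≤ 2 ^ n := one_le_pow₀ (by norm_num)
    have n3 : 1 ≤ b ^ (2 * n) := one_le_pow₀ hb
    rw [mul_pow, ← pow_mul]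
    have m1 : r * 2 ^ n ≤ r * (2 ^ n * b ^ (2 * n)) :=
      mul_le_mul_of_nonneg_left (le_mul_of_one_le_right (by positivity) n3) (by linarith)
    have m2 : b ^ (2 * n) ≤ r * (2 ^ n * b ^ (2 * n)) := by
      rw [← mul_assoc]
      exact le_mul_of_one_le_left (by positivity) (by nlinarith)
    nlinarith
  · rw [abs_div, abs_of_pos hLn, div_pow, div_right_comm]
    exact div_le_div_of_nonneg_right (h.noise_le n x) hLn.le

lemma abs_le_of_approx {k n : ℕ} (hn : 1 ≤ n) {x : Lat L n} {V : ℝ}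
    (hV : |V - effPotMain L r g ζ k n x| ≤ 38 * r * decayRate L b ^ (n + 1)) :
    |V / (L : ℝ) ^ (2 * n)| ≤ (b / L) ^ n := by
  have hL := h.L_pos
  have hb := h.one_le_b
  have hr := h.one_le_r
  obtain ⟨h1, h2⟩ := h.small_of_approx hV
  have e : V / (L : ℝ) ^ (2 * n) = (V / (L : ℝ) ^ (2 * n) - g * ζ n x / (L : ℝ) ^ n)
    + g * ζ n x / (L : ℝ) ^ n := by ring
  rw [e]
  refine (abs_add_le _ _).trans ?_
  have e2 : 3 * r * (2 * b ^ 2) ^ n / (L : ℝ) ^ (2 * n)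
      = (b / L) ^ n * (3 * r * (2 * (b / L)) ^ n) := by
    rw [pow_mul' (L : ℝ), mul_pow, mul_pow, div_pow, ← pow_mul, pow_mul' b]
    field_simp
  have h3 : (2 * (b / L)) ^ n ≤ decayRate L b := by
    have := h.div_pos
    refine (pow_le_of_le_one (by positivity) ?_ (by omega)).trans h.two_mul_div_le
    linarith [h.two_mul_div_le, h.decayRate_le]
  have h4 : 3 * r * (2 * (b / L)) ^ n ≤ 1 / 2 := by nlinarith [h.r_mul_decayRate]
  have h5 : 0 < (b / L) ^ n := pow_pos h.div_pos n
  rw [e2] at h1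
  nlinarith

variable [NeZero L]

/-- The effective potential agrees with its second order expansion up to a small error, uniformly
in the cutoff. The cubic errors of the single steps are summable over the scales. -/
lemma effPot_approx (k n : ℕ) (x : Lat L n) :
    |effPot L r g ζ k n x - effPotMain L r g ζ k n x| ≤ 38 * r * decayRate L b ^ (n + 1) := by
  have hL := h.L_pos
  have hb := h.one_le_b
  have hr := h.one_le_r
  have hq := h.decayRate_pos
  induction k generalizing n with
  | zero =>
    simp only [effPot, effPotMain, chaos, mul_zero, add_zero, sub_self, abs_zero]
    positivity
  | succ k ih =>
    have hA := isMean_latAvgLin (Nat.le_succ n) x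
    set m := n + 1 with hm
    set A := latAvgLin L m n x with hAdef
    have hLm : (0 : ℝ) < (L : ℝ) ^ (2 * m) := by positivity
    set v : Lat L m → ℝ := fun y => effPot L r g ζ k m y / (L : ℝ) ^ (2 * m) with hv
    set α : Lat L m → ℝ := fun y => g * ζ m y / (L : ℝ) ^ m with hα
    set s := (b / L) ^ m with hs
    have hs0 : 0 ≤ s := (pow_pos h.div_pos m).le
    have hs1 : s ≤ 1 / 10 := (h.div_pow_le (by omega)).trans (by norm_num)
    have key := abs_rgStep_expansion hA (v := v) (α := α) (s := s)
      (β := 3 * r * (2 * b ^ 2) ^ m / (L : ℝ) ^ (2 * m)) hs0 hs1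
      (fun y => h.abs_le_of_approx (by omega) (ih m y))
      (fun y => (h.small_of_approx (ih m y)).2.trans (by linarith))
      (fun y => (h.small_of_approx (ih m y)).1)
    -- the linear term reproduces the expansion one scale up
    have eAv : (L : ℝ) ^ (2 * m) * A v = A (effPot L r g ζ k m) := by
      rw [← smul_eq_mul, ← map_smul]
      congr 1
      ext y
      simp only [hv, Pi.smul_apply, smul_eq_mul]
      field_simp
    have eAmain : A (effPotMain L r g ζ k m) = g * ((L : ℝ) ^ n * ζ n x)
        + (r - (1 - ((L : ℝ) ^ 2)⁻¹) * m * g ^ 2)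
        + g ^ 2 * latAvg L m n (chaos L ζ k m) x := by
      have e : effPotMain L r g ζ k m = (g * (L : ℝ) ^ m) • ζ m
          + (fun _ => (r - (1 - ((L : ℝ) ^ 2)⁻¹) * m * g ^ 2))
          + (g ^ 2) • chaos L ζ k m := by
        ext y
        simp only [effPotMain, Pi.add_apply, Pi.smul_apply, smul_eq_mul]
        ring
      rw [e, map_add, map_add, map_smul, map_smul, hA.const]
      have c := h.consistent n x
      change (g * (L : ℝ) ^ m) * latAvg L m n (ζ m) x + _ + g ^ 2 * latAvg L m n _ x = _
      rw [c, hm, pow_succ]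
      field_simp
    have eAα : (L : ℝ) ^ (2 * m) * (A (fun y => α y ^ 2) - A α ^ 2)
        = g ^ 2 * (latAvg L m n (fun y => ζ m y ^ 2) x - ζ n x ^ 2 / (L : ℝ) ^ 2) := by
      have e1 : (fun y => α y ^ 2) = (g ^ 2 / (L : ℝ) ^ (2 * m)) • fun y => ζ m y ^ 2 := by
        ext y
        simp only [hα, Pi.smul_apply, smul_eq_mul, pow_mul' (L : ℝ)]
        field_simp
      have e2 : α = (g / (L : ℝ) ^ m) • ζ m := by
        ext y
        simp only [hα, Pi.smul_apply, smul_eq_mul]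
        field_simp
      rw [e1, map_smul, e2, map_smul]
      have c := h.consistent n x
      change _ * (_ * latAvg L m n _ x - (_ * latAvg L m n (ζ m) x) ^ 2) = _
      rw [c, pow_mul' (L : ℝ)]
      field_simp
    have hR : |A (effPot L r g ζ k m) - A (effPotMain L r g ζ k m)|
        ≤ 38 * r * decayRate L b ^ (m + 1) := hA.abs_apply_sub_le fun y => ih m y
    have hstep : effPot L r g ζ (k + 1) n x
        = (L : ℝ) ^ (2 * m) * (1 - (A fun y => (1 - v y)⁻¹)⁻¹) := rfl
    have hchaos : chaos L ζ (k + 1) n x = latAvg L m n (chaos L ζ k m) x +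
      (latAvg L m n (fun y => ζ m y ^ 2) x - ζ n x ^ 2 / (L : ℝ) ^ 2
        - (1 - ((L : ℝ) ^ 2)⁻¹)) := rfl
    have hfin : effPot L r g ζ (k + 1) n x - effPotMain L r g ζ (k + 1) n x
        = (L : ℝ) ^ (2 * m) * (1 - (A fun y => (1 - v y)⁻¹)⁻¹
            - (A v + A (fun i => α i ^ 2) - A α ^ 2))
          + (A (effPot L r g ζ k m) - A (effPotMain L r g ζ k m)) := by
      have : (m : ℝ) = n + 1 := by rw [hm]; push_cast; ring
      rw [eAmain, hstep, effPotMain, hchaos, this]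
      linear_combination eAv + eAα
    rw [hfin]
    refine (abs_add_le _ _).trans ?_
    rw [abs_mul, abs_of_pos hLm]
    have err : (L : ℝ) ^ (2 * m) * (7 * s ^ 3
        + 4 * s * (3 * r * (2 * b ^ 2) ^ m / (L : ℝ) ^ (2 * m)))
        ≤ 19 * r * decayRate L b ^ m := by
      have e1 : (L : ℝ) ^ (2 * m) * s ^ 3 = (b ^ 3 / L) ^ m := by
        rw [hs, div_pow, div_pow, div_pow, pow_mul' (L : ℝ), pow_right_comm b 3 m]
        field_simp
      have e2 : s * (2 * b ^ 2) ^ m = decayRate L b ^ m := by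
        rw [hs, ← mul_pow, decayRate]
        congr 1
        field_simp
      have e3 : (b ^ 3 / L) ^ m ≤ decayRate L b ^ m := by
        refine pow_le_pow_left₀ (by positivity) ?_ m
        rw [decayRate]
        refine div_le_div_of_nonneg_right ?_ hL.le
        linarith [pow_pos (by linarith : 0 < b) 3]
      have e4 : (L : ℝ) ^ (2 * m) * (7 * s ^ 3
        + 4 * s * (3 * r * (2 * b ^ 2) ^ m / (L : ℝ) ^ (2 * m)))
        = 7 * ((L : ℝ) ^ (2 * m) * s ^ 3) + 12 * r * (s * (2 * b ^ 2) ^ m) := by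
        field_simp
        ring
      rw [e4, e1, e2]
      have : 0 < decayRate L b ^ m := by positivity
      nlinarith
    have hlast : decayRate L b ^ (m + 1) ≤ decayRate L b ^ m * (1 / 1000) := by
      rw [pow_succ]
      exact mul_le_mul_of_nonneg_left h.decayRate_le (by positivity)
    have h1 := mul_le_mul_of_nonneg_left key hLm.le
    have : 0 < decayRate L b ^ m := by positivity
    nlinarith [mul_le_mul_of_nonneg_left hlast (by linarith : (0 : ℝ) ≤ r)]

lemma effPot_small (k : ℕ) {n : ℕ} (hn : 1 ≤ n) (x : Lat L n) :
    |effPot L r g ζ k n x / (L : ℝ) ^ (2 * n)| ≤ (b / L) ^ n :=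
  h.abs_le_of_approx hn (h.effPot_approx k n x)

lemma effPot_zero_ge (k : ℕ) (x : Lat L 0) : 1 / 8 ≤ effPot L r g ζ k 0 x := by
  have h1 := h.effPot_approx k 0 x
  have h2 := h.noise_le 0 x
  have h3 := h.chaos_le k 0 x
  have hr := h.one_le_r
  have h4 := h.r_mul_decayRate
  simp only [effPotMain, pow_zero, one_mul, Nat.cast_zero, mul_zero, zero_mul, sub_zero, zero_add,
    pow_one] at h1 h2 h3
  have a1 := (abs_le.1 h1).1
  have a2 := (abs_le.1 h2).1
  have a3 := (abs_le.1 h3).1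
  nlinarith

end
end IsRegular

/-- Weights increasing from `1 / 2` to `1`, which absorb the factors `1 + 8 s` lost over the
scales. -/
def scaleWeight (n : ℕ) : ℝ := 1 - (1 / 4) ^ n / 2

lemma half_le_scaleWeight (n : ℕ) : 1 / 2 ≤ scaleWeight n := by
  have : (1 / 4 : ℝ) ^ n ≤ 1 := pow_le_one₀ (by norm_num) (by norm_num)
  rw [scaleWeight]; linarith

lemma scaleWeight_le_one (n : ℕ) : scaleWeight n ≤ 1 := by
  have : 0 ≤ (1 / 4 : ℝ) ^ n := by positivity
  rw [scaleWeight]; linarith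

lemma scaleWeight_succ {a : ℝ} (h0 : 0 ≤ a) (ha : a ≤ 1 / 2000) (n : ℕ) :
    scaleWeight n * (1 + 8 * a ^ (n + 1)) ≤ scaleWeight (n + 1) := by
  have h1 : a ^ n ≤ (1 / 4) ^ n := pow_le_pow_left₀ h0 (by linarith) n
  have h2 : a ^ (n + 1) ≤ (1 / 4) ^ n * (1 / 2000) := by
    rw [pow_succ]
    exact mul_le_mul h1 ha h0 (by positivity)
  have h3 : 0 ≤ a ^ (n + 1) := by positivity
  have h4 := scaleWeight_le_one n
  have h5 : scaleWeight n * a ^ (n + 1) ≤ (1 / 4) ^ n * (1 / 2000) := by nlinarith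
  have h6 : scaleWeight (n + 1) = scaleWeight n + 3 / 8 * (1 / 4) ^ n := by
    rw [scaleWeight, scaleWeight, pow_succ]; ring
  have : (0 : ℝ) ≤ (1 / 4) ^ n := by positivity
  rw [h6]
  nlinarith

namespace IsRegular

variable [NeZero L] {r g b : ℝ} {ζ : ∀ n, Lat L n → ℝ} (h : IsRegular L r g b ζ)
include h

lemma abs_effPot_succ_sub_le {k k' n : ℕ} {δ : ℝ}
    (H : ∀ y, |effPot L r g ζ k (n + 1) y - effPot L r g ζ k' (n + 1) y| ≤ δ)
    (hδ : 0 ≤ δ) (x : Lat L n) :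
    |effPot L r g ζ (k + 1) n x - effPot L r g ζ (k' + 1) n x| ≤ (1 + 8 * (b / L) ^ (n + 1)) * δ := by
  have hL := h.L_pos
  have hLm : (0 : ℝ) < (L : ℝ) ^ (2 * (n + 1)) := by positivity
  have key := abs_rgStep_sub_le (isMean_latAvgLin (Nat.le_succ n) x)
    (v := fun y => effPot L r g ζ k (n + 1) y / (L : ℝ) ^ (2 * (n + 1)))
    (w := fun y => effPot L r g ζ k' (n + 1) y / (L : ℝ) ^ (2 * (n + 1)))
    (s := (b / L) ^ (n + 1)) (δ := δ / (L : ℝ) ^ (2 * (n + 1)))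
    (pow_pos h.div_pos _).le ((h.div_pow_le (by omega)).trans (by norm_num))
    (fun y => h.effPot_small k (by omega) y) (fun y => h.effPot_small k' (by omega) y)
    (fun y => by
      rw [← sub_div, abs_div, abs_of_pos hLm]
      exact div_le_div_of_nonneg_right (H y) hLm.le) (by positivity)
  have e : effPot L r g ζ (k + 1) n x - effPot L r g ζ (k' + 1) n x = (L : ℝ) ^ (2 * (n + 1)) *
      ((1 - (latAvgLin L (n + 1) n x
          fun y => (1 - effPot L r g ζ k (n + 1) y / (L : ℝ) ^ (2 * (n + 1)))⁻¹)⁻¹)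
        - (1 - (latAvgLin L (n + 1) n x
          fun y => (1 - effPot L r g ζ k' (n + 1) y / (L : ℝ) ^ (2 * (n + 1)))⁻¹)⁻¹)) := by
    rw [mul_sub]; rfl
  rw [e, abs_mul, abs_of_pos hLm]
  refine (mul_le_mul_of_nonneg_left key hLm.le).trans (le_of_eq ?_)
  field_simp

/-- Differences of the effective potential do not grow, up to a factor `2`, when going to coarser
scales. -/
lemma abs_effPot_sub_le {N N' m n : ℕ} (hn : n ≤ m) (hN : m ≤ N) (hN' : m ≤ N') {δ : ℝ}
    (hδ : 0 ≤ δ) (H : ∀ y, |effPot L r g ζ (N - m) m y - effPot L r g ζ (N' - m) m y| ≤ δ)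
    (x : Lat L n) :
    |effPot L r g ζ (N - n) n x - effPot L r g ζ (N' - n) n x| ≤ 2 * δ := by
  have key : ∀ x : Lat L n,
      |effPot L r g ζ (N - n) n x - effPot L r g ζ (N' - n) n x| ≤ δ / scaleWeight n := by
    clear x
    induction hn using Nat.decreasingInduction with
    | self =>
      intro x
      refine (H x).trans (le_div_self hδ ?_ (scaleWeight_le_one m))
      linarith [half_le_scaleWeight m]
    | of_succ j hj ih =>
      intro x
      have w0 := half_le_scaleWeight j
      have w1 := half_le_scaleWeight (j + 1)
      have hd : 0 ≤ δ / scaleWeight (j + 1) := div_nonneg hδ (by linarith)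
      have e : N - j = (N - (j + 1)) + 1 := by omega
      have e' : N' - j = (N' - (j + 1)) + 1 := by omega
      rw [e, e']
      refine (h.abs_effPot_succ_sub_le (fun y => ih y) hd x).trans ?_
      have := scaleWeight_succ h.div_pos.le h.div_le j
      rw [le_div_iff₀ (by linarith)]
      calc (1 + 8 * (b / L) ^ (j + 1)) * (δ / scaleWeight (j + 1)) * scaleWeight j
          = (scaleWeight j * (1 + 8 * (b / L) ^ (j + 1))) * (δ / scaleWeight (j + 1)) := by ring
        _ ≤ scaleWeight (j + 1) * (δ / scaleWeight (j + 1)) := mul_le_mul_of_nonneg_right this hd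
        _ = δ := mul_div_cancel₀ _ (by linarith)
  refine (key x).trans ?_
  rw [div_le_iff₀ (by linarith [half_le_scaleWeight n])]
  nlinarith [half_le_scaleWeight n]

/-- If the second chaos converges as the cutoff is removed, so does the effective potential. -/
lemma exists_tendsto_effPot
    (hX : ∀ n x, ∃ l, Tendsto (fun k => chaos L ζ k n x) atTop (𝓝 l)) (n : ℕ) (x : Lat L n) :
    ∃ l, Tendsto (fun N => effPot L r g ζ (N - n) n x) atTop (𝓝 l) := by
  refine cauchySeq_tendsto_of_complete (Metric.cauchySeq_iff'.2 fun ε hε => ?_)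
  have hq0 := h.decayRate_pos
  have hr := h.one_le_r
  -- a scale on which the remainder is negligible
  obtain ⟨m, hnm, hm⟩ : ∃ m, n ≤ m ∧ 38 * r * decayRate L b ^ (m + 1) ≤ ε / 16 := by
    have : Tendsto (fun m => 38 * r * decayRate L b ^ (m + 1)) atTop (𝓝 (38 * r * 0)) :=
      ((tendsto_pow_atTop_nhds_zero_of_lt_one hq0.le
        (by linarith [h.decayRate_le])).comp (tendsto_add_atTop_nat 1)).const_mul _
    rw [mul_zero] at this
    obtain ⟨m, h1, h2⟩ := ((eventually_ge_atTop n).and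
      (this.eventually (ge_mem_nhds (by positivity : 0 < ε / 16)))).exists
    exact ⟨m, h1, h2⟩
  -- beyond it the second chaos at that scale has converged
  obtain ⟨M, hM⟩ : ∃ M, ∀ k ≥ M, ∀ y : Lat L m,
      |chaos L ζ k m y - chaos L ζ M m y| ≤ ε / 8 := by
    have : ∀ y : Lat L m, ∃ l, ∀ᶠ k in atTop, |chaos L ζ k m y - l| ≤ ε / 16 := by
      intro y
      obtain ⟨l, hl⟩ := hX m y
      exact ⟨l, (Metric.tendsto_nhds.1 hl (ε / 16) (by positivity)).mono fun k hk => by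
        rw [Real.dist_eq] at hk; exact hk.le⟩
    choose l hl using this
    obtain ⟨M, hM⟩ := eventually_atTop.1 (eventually_all.2 hl)
    refine ⟨M, fun k hk y => ?_⟩
    have a1 := hM k hk y
    have a2 := hM M le_rfl y
    rw [abs_sub_comm] at a2
    have := abs_sub_le (chaos L ζ k m y) (l y) (chaos L ζ M m y)
    linarith
  refine ⟨m + M, fun N hN => ?_⟩
  rw [Real.dist_eq]
  refine (h.abs_effPot_sub_le (m := m) (δ := ε / 4) hnm (by omega) (by omega) (by positivity)
    (fun y => ?_) x).trans_lt (by linarith)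
  have e : m + M - m = M := by omega
  rw [e]
  have a1 := (h.effPot_approx (N - m) m y).trans hm
  have a2 := (h.effPot_approx M m y).trans hm
  have a3 := hM (N - m) (by omega) y
  have a4 : |effPotMain L r g ζ (N - m) m y - effPotMain L r g ζ M m y| ≤ ε / 8 := by
    have : effPotMain L r g ζ (N - m) m y - effPotMain L r g ζ M m y
        = g ^ 2 * (chaos L ζ (N - m) m y - chaos L ζ M m y) := by
      simp only [effPotMain]; ring
    rw [this, abs_mul, abs_of_pos (pow_pos h.g_pos 2)]
    have : g ^ 2 ≤ 1 := pow_le_one₀ h.g_pos.le h.g_le_one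
    nlinarith [abs_nonneg (chaos L ζ (N - m) m y - chaos L ζ M m y)]
  rw [abs_le] at *
  constructor <;> linarith

end IsRegular

end Flow

/-! ### The solution as a multiplicative cascade -/

section Cascade

variable {L : ℕ} [NeZero L]

/-- The factor `(1 - V / L²ⁿ)⁻¹` by which the solution is modulated at scale `n`. -/
def modulation (L n : ℕ) (V : Lat L n → ℝ) (y : Lat L n) : ℝ := (1 - V y / (L : ℝ) ^ (2 * n))⁻¹

/-- The multiplicative cascade driven by a family of potentials `V` on all scales. It starts from
the solution `-1 / V 0` of the equation at scale zero, and on each finer scale it is multiplied by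
the normalised modulation. -/
def cascade (L : ℕ) [NeZero L] (V : ∀ n, Lat L n → ℝ) : ∀ n, Lat L n → ℝ
  | 0, x => -1 / V 0 x
  | n + 1, y => cascade L V n (anc L (n + 1) n y) * (modulation L (n + 1) (V (n + 1)) y /
      latAvg L (n + 1) n (modulation L (n + 1) (V (n + 1))) (anc L (n + 1) n y))

/-- A family of potentials on the scales `0, …, N`, linked by renormalisation steps, small on
positive scales and bounded below at scale zero. -/
structure IsPotential (L : ℕ) (a : ℝ) (N : ℕ) (V : ∀ n, Lat L n → ℝ) : Prop where
  nonneg : 0 ≤ a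
  le : a ≤ 1 / 2000
  step : ∀ n < N, ∀ x, V n x = rgStep L n (V (n + 1)) x
  small : ∀ n, 1 ≤ n → n ≤ N → ∀ x, |V n x / (L : ℝ) ^ (2 * n)| ≤ a ^ n
  zero_ge : ∀ x, 1 / 8 ≤ V 0 x

/-- The size of the fluctuation of the cascade at one scale, relative to the next coarser one. -/
lemma abs_cascade_succ_sub_le {V : ∀ n, Lat L n → ℝ} {n : ℕ} {s : ℝ} (hs0 : 0 ≤ s) (hs : s ≤ 1 / 10)
    (hV : ∀ y, |V (n + 1) y / (L : ℝ) ^ (2 * (n + 1))| ≤ s) (y : Lat L (n + 1)) :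
    |cascade L V (n + 1) y - cascade L V n (anc L (n + 1) n y)|
      ≤ |cascade L V n (anc L (n + 1) n y)| * (4 * s) := by
  have key := abs_inv_div_mean_sub_one_le
    (isMean_latAvgLin (Nat.le_succ n) (anc L (n + 1) n y)) hs0 hs hV y
  have e : cascade L V (n + 1) y - cascade L V n (anc L (n + 1) n y)
      = cascade L V n (anc L (n + 1) n y) * (modulation L (n + 1) (V (n + 1)) y /
      latAvg L (n + 1) n (modulation L (n + 1) (V (n + 1))) (anc L (n + 1) n y) - 1) := by
    rw [cascade]; ring
  rw [e, abs_mul]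
  exact mul_le_mul_of_nonneg_left key (abs_nonneg _)

namespace IsPotential

variable {a : ℝ} {N : ℕ} {V : ∀ n, Lat L n → ℝ} (h : IsPotential L a N V)
include h

omit [NeZero L] in
lemma pow_le_tenth {n : ℕ} (hn : 1 ≤ n) : a ^ n ≤ 1 / 10 :=
  (pow_le_of_le_one h.nonneg (by linarith [h.le]) (by omega)).trans (by linarith [h.le])

omit [NeZero L] in
lemma one_sub_pos {n : ℕ} (h1 : 1 ≤ n) (hn : n ≤ N) (y : Lat L n) :
    0 < 1 - V n y / (L : ℝ) ^ (2 * n) := by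
  have := (abs_le.1 (h.small n h1 hn y)).2
  linarith [h.pow_le_tenth h1]

lemma latAvg_modulation_pos {n : ℕ} (hn : n < N) (x : Lat L n) :
    0 < latAvg L (n + 1) n (modulation L (n + 1) (V (n + 1))) x :=
  mean_inv_pos (isMean_latAvgLin (Nat.le_succ n) x) (pow_nonneg h.nonneg (n + 1))
    (h.pow_le_tenth (by omega)) (h.small (n + 1) (by omega) hn)

lemma latAvg_cascade_succ {n : ℕ} (hn : n < N) (x : Lat L n) :
    latAvg L (n + 1) n (cascade L V (n + 1)) x = cascade L V n x := by
  set c : Lat L n → ℝ := fun x => cascade L V n x /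
      latAvg L (n + 1) n (modulation L (n + 1) (V (n + 1))) x with hc
  have e : cascade L V (n + 1)
      = fun y => c (anc L (n + 1) n y) * modulation L (n + 1) (V (n + 1)) y := by
    funext y
    simp only [cascade, hc]
    ring
  rw [e, latAvg_anc_mul c, hc, div_mul_cancel₀]
  exact (h.latAvg_modulation_pos hn x).ne'

lemma latAvg_cascade {m n : ℕ} (hn : n ≤ m) (hm : m ≤ N) (x : Lat L n) :
    latAvg L m n (cascade L V m) x = cascade L V n x := by
  induction hn using Nat.decreasingInduction with
  | self => rw [latAvg_self]
  | of_succ j hj ih =>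
    rw [← latAvg_latAvg (Nat.le_succ j) hj, ← h.latAvg_cascade_succ (by omega)]
    congr 1
    funext y
    exact ih y

lemma abs_cascade_le {n : ℕ} (hn : n ≤ N) (x : Lat L n) : |cascade L V n x| ≤ 16 := by
  have key : |cascade L V n x| ≤ 16 * scaleWeight n := by
    induction n with
    | zero =>
      have h0 := h.zero_ge x
      rw [cascade, abs_div, abs_neg, abs_one, abs_of_pos (by linarith),
        div_le_iff₀ (by linarith), scaleWeight]
      linarith
    | succ n ih =>
      have h1 := abs_cascade_succ_sub_le (pow_nonneg h.nonneg (n + 1))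
        (h.pow_le_tenth (by omega)) (h.small (n + 1) (by omega) hn) x
      have h2 := ih (by omega) (anc L (n + 1) n x)
      have h3 := scaleWeight_succ h.nonneg h.le n
      have h4 := pow_nonneg h.nonneg (n + 1)
      have h5 := abs_sub_abs_le_abs_sub (cascade L V (n + 1) x)
        (cascade L V n (anc L (n + 1) n x))
      have h6 : |cascade L V n (anc L (n + 1) n x)| * (8 * a ^ (n + 1))
        ≤ 16 * scaleWeight n * (8 * a ^ (n + 1)) :=
        mul_le_mul_of_nonneg_right h2 (by positivity)
      have h7 : |cascade L V n (anc L (n + 1) n x)| * (4 * a ^ (n + 1))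
        ≤ |cascade L V n (anc L (n + 1) n x)| * (8 * a ^ (n + 1)) :=
        mul_le_mul_of_nonneg_left (by linarith) (abs_nonneg _)
      linarith
  linarith [scaleWeight_le_one n]

lemma abs_cascade_succ_sub_le' {n : ℕ} (hn : n < N) {s : ℝ} (hs0 : 0 ≤ s)
    (hV : ∀ y, |V (n + 1) y / (L : ℝ) ^ (2 * (n + 1))| ≤ s) (y : Lat L (n + 1)) :
    |cascade L V (n + 1) y - cascade L V n (anc L (n + 1) n y)| ≤ 64 * s := by
  have hb := h.abs_cascade_le hn.le (anc L (n + 1) n y)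
  rcases le_total s (a ^ (n + 1)) with hs | hs
  · refine (abs_cascade_succ_sub_le hs0 (hs.trans (h.pow_le_tenth (by omega))) hV y).trans ?_
    nlinarith
  · refine (abs_cascade_succ_sub_le (pow_nonneg h.nonneg (n + 1)) (h.pow_le_tenth (by omega))
      (h.small (n + 1) (by omega) hn) y).trans ?_
    nlinarith [pow_nonneg h.nonneg (n + 1)]

/-- The identity behind the telescoping of the hierarchical Laplacian along the cascade. -/
lemma pow_mul_cascade_sub {n : ℕ} (hn : n < N) (y : Lat L (n + 1)) :
    (L : ℝ) ^ (2 * (n + 1)) * (cascade L V (n + 1) y - cascade L V n (anc L (n + 1) n y))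
      = V (n + 1) y * cascade L V (n + 1) y
        - V n (anc L (n + 1) n y) * cascade L V n (anc L (n + 1) n y) := by
  have hL := L_pos (L := L)
  have h1 := h.one_sub_pos (n := n + 1) (by omega) hn y
  have h2 := h.latAvg_modulation_pos hn (anc L (n + 1) n y)
  have hLm : (0 : ℝ) < (L : ℝ) ^ (2 * (n + 1)) := by positivity
  rw [h.step n hn, rgStep, cascade]
  change _ = _ - (L : ℝ) ^ (2 * (n + 1)) * (1 - (latAvg L (n + 1) n
    (modulation L (n + 1) (V (n + 1))) (anc L (n + 1) n y))⁻¹) * _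
  set M := latAvg L (n + 1) n (modulation L (n + 1) (V (n + 1))) (anc L (n + 1) n y)
  have hm : modulation L (n + 1) (V (n + 1)) y * (1 - V (n + 1) y / (L : ℝ) ^ (2 * (n + 1))) = 1 :=
    inv_mul_cancel₀ h1.ne'
  set mo := modulation L (n + 1) (V (n + 1)) y
  have hm' : mo * ((L : ℝ) ^ (2 * (n + 1)) - V (n + 1) y) = (L : ℝ) ^ (2 * (n + 1)) := by
    field_simp at hm
    linarith
  field_simp
  linear_combination cascade L V n (anc L (n + 1) n y) * hm'

end IsPotential

omit [NeZero L] in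
lemma sum_Icc_one_eq_sum_range (N : ℕ) (f : ℕ → ℝ) :
    ∑ n ∈ Finset.Icc 1 N, f n = ∑ i ∈ Finset.range N, f (i + 1) := by
  induction N with
  | zero => simp
  | succ N ih => rw [Finset.sum_Icc_succ_top (by omega), Finset.sum_range_succ, ih]

lemma negLaplacian_eq (N : ℕ) (f : Lat L N → ℝ) (x : Lat L N) :
    negLaplacian L N f x = ∑ i ∈ Finset.range N, (L : ℝ) ^ (2 * (i + 1)) *
      (latAvg L N (i + 1) f (anc L N (i + 1) x) - latAvg L N i f (anc L N i x)) := by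
  rw [negLaplacian, sum_Icc_one_eq_sum_range]
  exact Finset.sum_congr rfl fun i _ => by rw [latFluct_apply]; rfl

namespace IsPotential

variable {a : ℝ} {N : ℕ} {V : ∀ n, Lat L n → ℝ} (h : IsPotential L a N V)
include h

lemma negLaplacian_cascade (x : Lat L N) :
    negLaplacian L N (cascade L V N) x = V N x * cascade L V N x + 1 := by
  rw [negLaplacian_eq]
  have e : ∀ i ∈ Finset.range N, (L : ℝ) ^ (2 * (i + 1)) *
      (latAvg L N (i + 1) (cascade L V N) (anc L N (i + 1) x)
        - latAvg L N i (cascade L V N) (anc L N i x))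
      = V (i + 1) (anc L N (i + 1) x) * cascade L V (i + 1) (anc L N (i + 1) x)
        - V i (anc L N i x) * cascade L V i (anc L N i x) := by
    intro i hi
    have hi : i < N := Finset.mem_range.1 hi
    rw [h.latAvg_cascade (by omega) le_rfl, h.latAvg_cascade (by omega) le_rfl,
      ← anc_anc (Nat.le_succ i) x, h.pow_mul_cascade_sub hi]
  rw [Finset.sum_congr rfl e,
    Finset.sum_range_sub fun i => V i (anc L N i x) * cascade L V i (anc L N i x), anc_self,
    cascade]
  have := h.zero_ge (anc L N 0 x)
  have h0 : V 0 (anc L N 0 x) ≠ 0 := by linarith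
  field_simp
  ring

/-- Any solution is the cascade: averaging the equation over coarser and coarser boxes gives the
effective equation on each scale. -/
lemma eq_cascade {v : Lat L N → ℝ} (hv : ∀ x, negLaplacian L N v x = V N x * v x + 1) :
    v = cascade L V N := by
  have hL := L_pos (L := L)
  set w : ∀ n, Lat L n → ℝ := fun n => latAvg L N n v with hw
  set D : ∀ n, Lat L n → ℝ := fun n x => ∑ i ∈ Finset.range n, (L : ℝ) ^ (2 * (i + 1)) *
    (w (i + 1) (anc L n (i + 1) x) - w i (anc L n i x)) with hD
  have hDsucc : ∀ n (y : Lat L (n + 1)), D (n + 1) y = D n (anc L (n + 1) n y)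
      + (L : ℝ) ^ (2 * (n + 1)) * (w (n + 1) y - w n (anc L (n + 1) n y)) := by
    intro n y
    simp only [hD, Finset.sum_range_succ, anc_self]
    congr 1
    refine Finset.sum_congr rfl fun i hi => ?_
    have hi : i < n := Finset.mem_range.1 hi
    rw [anc_anc (by omega), anc_anc (by omega)]
  set c : ∀ n, Lat L n → ℝ := fun n x => w n x + (1 - D n x) / (L : ℝ) ^ (2 * (n + 1)) with hc
  -- solving the equation at scale `n + 1` for the fluctuation
  have hloc : ∀ n < N, (∀ y, D (n + 1) y = V (n + 1) y * w (n + 1) y + 1) → ∀ y,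
      w (n + 1) y = c n (anc L (n + 1) n y) * modulation L (n + 1) (V (n + 1)) y := by
    intro n hn H y
    have h1 := h.one_sub_pos (n := n + 1) (by omega) hn y
    have H := H y
    rw [hDsucc] at H
    have hLm : (0 : ℝ) < (L : ℝ) ^ (2 * (n + 1)) := by positivity
    simp only [modulation, hc]
    rw [← div_eq_mul_inv, eq_div_iff h1.ne']
    field_simp
    linarith
  have hmean : ∀ n < N, (∀ y, D (n + 1) y = V (n + 1) y * w (n + 1) y + 1) → ∀ x,
      w n x = c n x * latAvg L (n + 1) n (modulation L (n + 1) (V (n + 1))) x := by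
    intro n hn H x
    have e : w n x = latAvg L (n + 1) n (w (n + 1)) x :=
      (latAvg_latAvg (Nat.le_succ n) hn v x).symm
    conv_lhs => rw [e, show w (n + 1) = _ from funext (hloc n hn H), latAvg_anc_mul (c n)]
  have hdown : ∀ n, n ≤ N → ∀ x, D n x = V n x * w n x + 1 := by
    intro n hn
    induction hn using Nat.decreasingInduction with
    | self =>
      intro x
      simp only [hw, hD, latAvg_self]
      rw [← hv, negLaplacian_eq]
    | of_succ j hj ih =>
      intro x
      have hLm : (0 : ℝ) < (L : ℝ) ^ (2 * (j + 1)) := by positivity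
      have hp := h.latAvg_modulation_pos hj x
      have e := hmean j hj ih x
      simp only [hc] at e
      rw [h.step j hj, rgStep]
      change _ = (L : ℝ) ^ (2 * (j + 1)) * (1 - (latAvg L (j + 1) j
        (modulation L (j + 1) (V (j + 1))) x)⁻¹) * _ + 1
      set M := latAvg L (j + 1) j (modulation L (j + 1) (V (j + 1))) x
      field_simp at e ⊢
      linarith
  have hup : ∀ n, n ≤ N → ∀ x, w n x = cascade L V n x := by
    intro n
    induction n with
    | zero =>
      intro _ x
      have h0 := hdown 0 (Nat.zero_le _) x
      have := h.zero_ge x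
      simp only [hD, Finset.range_zero, Finset.sum_empty] at h0
      rw [cascade, eq_div_iff (by linarith)]
      linarith
    | succ n ih =>
      intro hn y
      have hp := h.latAvg_modulation_pos hn (anc L (n + 1) n y)
      have e1 := hloc n hn (hdown (n + 1) hn) y
      have e2 := hmean n hn (hdown (n + 1) hn) (anc L (n + 1) n y)
      rw [cascade, ← ih (by omega), e1]
      rw [mul_div_assoc', eq_div_iff hp.ne']
      linear_combination -modulation L (n + 1) (V (n + 1)) y * e2
  funext x
  rw [← hup N le_rfl x, hw]
  simp only [latAvg_self]

end IsPotential

/-- The cascade depends continuously on the potentials. -/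
lemma tendsto_cascade {V : ℕ → ∀ n, Lat L n → ℝ} {W : ∀ n, Lat L n → ℝ} {a : ℝ}
    (hW : ∀ N, IsPotential L a N W)
    (hV : ∀ n x, Tendsto (fun N => V N n x) atTop (𝓝 (W n x))) (n : ℕ) (x : Lat L n) :
    Tendsto (fun N => cascade L (V N) n x) atTop (𝓝 (cascade L W n x)) := by
  induction n with
  | zero =>
    have := (hW 0).zero_ge x
    exact (tendsto_const_nhds).div (hV 0 x) (by linarith)
  | succ n ih =>
    have hmod : ∀ y : Lat L (n + 1), Tendsto (fun N => modulation L (n + 1) (V N (n + 1)) y) atTop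
        (𝓝 (modulation L (n + 1) (W (n + 1)) y)) := fun y =>
      ((tendsto_const_nhds).sub ((hV (n + 1) y).div_const _)).inv₀
        ((hW (n + 1)).one_sub_pos (by omega) le_rfl y).ne'
    refine (ih _).mul ((hmod x).div ?_ ((hW (n + 1)).latAvg_modulation_pos (by omega) _).ne')
    simp only [latAvg]
    exact (tendsto_finsetSum _ fun y _ => hmod y).const_mul _

end Cascade

/-- The effective potentials for a fixed cutoff form a family of potentials. -/
lemma IsRegular.isPotential {L : ℕ} [NeZero L] {r g b : ℝ} {ζ : ∀ n, Lat L n → ℝ}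
    (h : IsRegular L r g b ζ) (N : ℕ) :
    IsPotential L (b / L) N (fun n => effPot L r g ζ (N - n) n) where
  nonneg := h.div_pos.le
  le := h.div_le
  step n hn x := by
    have : N - n = (N - (n + 1)) + 1 := by omega
    simp only [this, effPot]
  small n hn _ x := h.effPot_small _ hn x
  zero_ge x := h.effPot_zero_ge _ x

/-- Limits of the effective potentials form a family of potentials on all scales. -/
lemma IsRegular.isPotential_of_tendsto {L : ℕ} [NeZero L] {r g b : ℝ} {ζ : ∀ n, Lat L n → ℝ}
    (h : IsRegular L r g b ζ) {W : ∀ n, Lat L n → ℝ}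
    (hW : ∀ n x, Tendsto (fun N => effPot L r g ζ (N - n) n x) atTop (𝓝 (W n x))) (N : ℕ) :
    IsPotential L (b / L) N W where
  nonneg := h.div_pos.le
  le := h.div_le
  small n hn _ x := le_of_tendsto ((hW n x).div_const _).abs
    (Eventually.of_forall fun M => h.effPot_small _ hn x)
  zero_ge x := ge_of_tendsto (hW 0 x) (Eventually.of_forall fun M => h.effPot_zero_ge _ x)
  step n hn x := by
    refine tendsto_nhds_unique (hW n x) ?_
    have hsmall : ∀ y, |W (n + 1) y / (L : ℝ) ^ (2 * (n + 1))| ≤ (b / L) ^ (n + 1) := fun y =>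
      le_of_tendsto ((hW (n + 1) y).div_const _).abs
        (Eventually.of_forall fun M => h.effPot_small _ (by omega) y)
    have hs : (b / L) ^ (n + 1) ≤ 1 / 10 := (h.div_pow_le (by omega)).trans (by norm_num)
    have e : ∀ᶠ M in atTop, rgStep L n (effPot L r g ζ (M - (n + 1)) (n + 1)) x
        = effPot L r g ζ (M - n) n x := by
      filter_upwards [eventually_ge_atTop (n + 1)] with M hM
      have : M - n = (M - (n + 1)) + 1 := by omega
      rw [this, effPot]
    refine Tendsto.congr' e ?_
    refine Tendsto.const_mul _ (tendsto_const_nhds.sub (Tendsto.inv₀ ?_ ?_))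
    · simp only [latAvg]
      refine Tendsto.const_mul _ (tendsto_finsetSum _ fun y _ => ?_)
      refine Tendsto.inv₀ (tendsto_const_nhds.sub ((hW (n + 1) y).div_const _)) ?_
      have := (abs_le.1 (hsmall y)).2
      linarith
    · exact (mean_inv_pos (isMean_latAvgLin (Nat.le_succ n) x) (pow_nonneg h.div_pos.le _) hs
        hsmall).ne'

/-! ### Functions on the torus and the Hölder–Besov norm -/

section Torus

variable {L : ℕ}

lemma torusAvg_neg (n : ℕ) (w : (Fin 2 → ℝ) → ℝ) (x : Lat L n) :
    torusAvg L n (fun y => -w y) x = -torusAvg L n w x := by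
  simp only [torusAvg, integral_neg, mul_neg]

lemma besovNorm_neg (β : ℝ) (w : (Fin 2 → ℝ) → ℝ) :
    besovNorm L β (fun y => -w y) = besovNorm L β w := by
  have h : ∀ n y, |torusFluct L n (fun y => -w y) y| = |torusFluct L n w y| := by
    intro n y
    rw [← abs_neg]
    congr 1
    simp only [torusFluct, step, funext (torusAvg_neg n w), funext (torusAvg_neg (n - 1) w),
      indicator_neg, Finset.sum_neg_distrib]
    ring
  simp only [besovNorm, integral_neg, abs_neg, h]

lemma besovNorm_sub_comm (β : ℝ) (f h : (Fin 2 → ℝ) → ℝ) :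
    besovNorm L β (fun y => f y - h y) = besovNorm L β (fun y => h y - f y) := by
  rw [← besovNorm_neg]
  simp only [neg_sub]

lemma besovNorm_le {β A B : ℝ} {w : (Fin 2 → ℝ) → ℝ} (hA : |∫ y in torus, w y| ≤ A)
    (hB : ∀ n : ℕ, ∀ z ∈ torus, (L : ℝ) ^ (β * (n + 1 : ℕ)) * |torusFluct L (n + 1) w z| ≤ B) :
    besovNorm L β w ≤ ENNReal.ofReal A + ENNReal.ofReal B := by
  refine add_le_add (ENNReal.ofReal_le_ofReal hA) ?_
  refine iSup_le fun n => iSup_le fun hn => iSup_le fun z => iSup_le fun hz => ?_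
  obtain ⟨m, rfl⟩ : ∃ m, n = m + 1 := ⟨n - 1, by omega⟩
  exact ENNReal.ofReal_le_ofReal (hB m z hz)

variable [NeZero L]

lemma integral_torus_eq (w : (Fin 2 → ℝ) → ℝ) (x : Lat L 0) :
    ∫ y in torus, w y = torusAvg L 0 w x := by
  rw [torusAvg, box_zero]; simp

lemma torusFluct_succ (n : ℕ) (w : (Fin 2 → ℝ) → ℝ) {z : Fin 2 → ℝ} (hz : z ∈ torus) :
    torusFluct L (n + 1) w z
      = torusAvg L (n + 1) w (cell L (n + 1) z) - torusAvg L n w (cell L n z) := by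
  rw [torusFluct, step_apply _ hz]
  exact congrArg _ (step_apply (torusAvg L n w) hz)

lemma torusAvg_sub {w v : (Fin 2 → ℝ) → ℝ} (hw : IntegrableOn w torus) (hv : IntegrableOn v torus)
    {n : ℕ} (x : Lat L n) :
    torusAvg L n (fun y => w y - v y) x = torusAvg L n w x - torusAvg L n v x := by
  rw [torusAvg, torusAvg, torusAvg, integral_sub (hw.mono_set (box_subset_torus x))
    (hv.mono_set (box_subset_torus x)), mul_sub]

lemma integrable_indicator_box {n : ℕ} (x : Lat L n) (c : ℝ) :
    Integrable ((box L n x).indicator fun _ => c) := by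
  rw [integrable_indicator_iff (measurableSet_box L n x)]
  exact integrableOn_const (by rw [volume_box]; exact ENNReal.ofReal_ne_top)

lemma integrable_step {n : ℕ} (f : Lat L n → ℝ) : Integrable (step L n f) :=
  integrable_finsetSum _ fun x _ => integrable_indicator_box x (f x)

omit [NeZero L] in
lemma measurable_step {n : ℕ} (f : Lat L n → ℝ) : Measurable (step L n f) :=
  Finset.measurable_fun_sum _ fun x _ => measurable_const.indicator (measurableSet_box L n x)

lemma torusAvg_step_of_le {N n : ℕ} (h : n ≤ N) (f : Lat L N → ℝ) (x : Lat L n) :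
    torusAvg L n (step L N f) x = latAvg L N n f x := by
  have hL := L_pos (L := L)
  have e : ∀ y : Lat L N, ∫ z in box L n x, (box L N y).indicator (fun _ => f y) z
      = if anc L N n y = x then ((L : ℝ) ^ (2 * N))⁻¹ * f y else 0 := by
    intro y
    rw [setIntegral_indicator (measurableSet_box L N y)]
    split_ifs with hy
    · rw [inter_eq_right.2 (hy ▸ box_subset_box_anc h y), setIntegral_const_box]
    · have : box L n x ∩ box L N y = ∅ := by
        rw [eq_empty_iff_forall_notMem]
        rintro z ⟨hz1, hz2⟩
        have hz := box_subset_torus y hz2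
        rw [mem_box_iff_cell hz] at hz1 hz2
        exact hy (by rw [← hz1, ← hz2, anc_cell h hz])
      rw [this, setIntegral_empty]
  have e2 : ∫ z in box L n x, step L N f z
      = ∑ y : Lat L N, ∫ z in box L n x, (box L N y).indicator (fun _ => f y) z :=
    integral_finsetSum _ fun y _ => (integrable_indicator_box y (f y)).integrableOn
  rw [torusAvg, e2, Finset.sum_congr rfl fun y _ => e y, latAvg_eq, Finset.sum_filter,
    Finset.mul_sum, Finset.mul_sum]
  refine Finset.sum_congr rfl fun y _ => ?_
  split_ifs
  · have : (L : ℝ) ^ (2 * N) = (L : ℝ) ^ (2 * n) * (L : ℝ) ^ (2 * (N - n)) := by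
      rw [← pow_add]; congr 1; omega
    rw [this]
    field_simp
  · simp

lemma torusAvg_step_of_ge {N n : ℕ} (h : N ≤ n) (f : Lat L N → ℝ) (x : Lat L n) :
    torusAvg L n (step L N f) x = f (anc L n N x) := by
  have hL := L_pos (L := L)
  have e : ∫ z in box L n x, step L N f z = ∫ z in box L n x, f (anc L n N x) := by
    refine setIntegral_congr_fun (measurableSet_box L n x) fun z hz => ?_
    have hz' := box_subset_torus x hz
    rw [mem_box_iff_cell hz'] at hz
    simp only [step_apply f hz', ← hz, anc_cell h hz']
  rw [torusAvg, e, setIntegral_const_box]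
  field_simp

/-- The function on the torus with block averages `U n`, the pointwise limit of the step functions.
It takes a junk value where the limit does not exist, which does not happen below. -/
def torusLimit (L : ℕ) (U : ∀ n, Lat L n → ℝ) (z : Fin 2 → ℝ) : ℝ :=
  limUnder atTop fun n => step L n (U n) z

end Torus

section Limit

variable {L : ℕ} [NeZero L] {a : ℝ} {W : ∀ n, Lat L n → ℝ} (hW : ∀ N, IsPotential L a N W)
include hW

lemma tendsto_step_cascade (z : Fin 2 → ℝ) :
    Tendsto (fun n => step L n (cascade L W n) z) atTop (𝓝 (torusLimit L (cascade L W) z)) := by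
  refine tendsto_nhds_limUnder ?_
  by_cases hz : z ∈ torus
  · simp only [step_apply _ hz]
    have ha : a < 1 := by linarith [(hW 0).le]
    refine cauchySeq_tendsto_of_complete
      (cauchySeq_of_le_geometric a (64 * a) ha fun n => ?_)
    rw [dist_comm, Real.dist_eq, ← anc_cell (Nat.le_succ n) hz]
    refine ((hW (n + 1)).abs_cascade_succ_sub_le' (by omega) (pow_nonneg (hW 0).nonneg (n + 1))
      ((hW (n + 1)).small (n + 1) (by omega) le_rfl) _).trans (le_of_eq ?_)
    ring
  · refine ⟨0, ?_⟩
    have : ∀ n, step L n (cascade L W n) z = 0 := fun n => Finset.sum_eq_zero fun x _ =>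
      indicator_of_notMem (fun hx => hz (box_subset_torus x hx)) _
    simp only [this]
    exact tendsto_const_nhds

lemma abs_step_cascade_le (n : ℕ) (z : Fin 2 → ℝ) : |step L n (cascade L W n) z| ≤ 16 := by
  by_cases hz : z ∈ torus
  · rw [step_apply _ hz]
    exact (hW n).abs_cascade_le le_rfl _
  · have : step L n (cascade L W n) z = 0 := Finset.sum_eq_zero fun x _ =>
      indicator_of_notMem (fun hx => hz (box_subset_torus x hx)) _
    rw [this]; norm_num

lemma integrableOn_torusLimit_cascade : IntegrableOn (torusLimit L (cascade L W)) torus := by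
  have hm : Measurable (torusLimit L (cascade L W)) :=
    measurable_of_tendsto_metrizable (fun n => measurable_step (cascade L W n))
      (tendsto_pi_nhds.2 fun z => tendsto_step_cascade hW z)
  refine IntegrableOn.of_bound ?_ hm.aestronglyMeasurable 16 (ae_of_all _ fun z => ?_)
  · rw [← box_zero (L := L) (cell L 0 0), volume_box]
    exact ENNReal.ofReal_lt_top
  · exact le_of_tendsto (tendsto_step_cascade hW z).abs
      (Eventually.of_forall fun n => abs_step_cascade_le hW n z)

lemma torusAvg_torusLimit_cascade {n : ℕ} (x : Lat L n) :
    torusAvg L n (torusLimit L (cascade L W)) x = cascade L W n x := by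
  have h1 : Tendsto (fun m => torusAvg L n (step L m (cascade L W m)) x) atTop
      (𝓝 (torusAvg L n (torusLimit L (cascade L W)) x)) := by
    refine Tendsto.const_mul _ (tendsto_integral_of_dominated_convergence (fun _ => 16) ?_ ?_ ?_ ?_)
    · exact fun m => (measurable_step _).aestronglyMeasurable
    · exact integrableOn_const (by rw [volume_box]; exact ENNReal.ofReal_ne_top)
    · exact fun m => ae_of_all _ fun z => abs_step_cascade_le hW m z
    · exact ae_of_all _ fun z => tendsto_step_cascade hW z
  refine tendsto_nhds_unique h1 (tendsto_const_nhds.congr' ?_)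
  filter_upwards [eventually_ge_atTop n] with m hm
  rw [torusAvg_step_of_le hm, (hW m).latAvg_cascade hm le_rfl]

/-- Convergence of the cascades in the Hölder–Besov norm. The fluctuations on fine scales are
uniformly small, by the bound on the potentials, and those on each fixed scale converge. -/
lemma memBesov_and_tendsto_of_potentials {V : ℕ → ∀ n, Lat L n → ℝ}
    (hL : 1 < (L : ℝ)) (hV : ∀ N, IsPotential L a N (V N))
    (hVW : ∀ n x, Tendsto (fun N => V N n x) atTop (𝓝 (W n x))) {K : ℝ}
    (hK : ∀ N n, 1 ≤ n → n ≤ N → ∀ x,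
      |V N n x / (L : ℝ) ^ (2 * n)| ≤ K * (n + 1) / (L : ℝ) ^ n)
    {κ : ℝ} (hκ0 : 0 < κ) (hκ1 : κ < 1) :
    MemBesov L (1 - κ) (torusLimit L (cascade L W)) ∧
      Tendsto (fun N => besovNorm L (1 - κ)
        (fun y => step L N (cascade L (V N) N) y - torusLimit L (cascade L W) y))
        atTop (𝓝 0) := by
  set uS := torusLimit L (cascade L W) with huS
  have hL0 : (0 : ℝ) < L := by linarith
  have hint := integrableOn_torusLimit_cascade hW
  have hpow : ∀ n : ℕ, (L : ℝ) ^ ((1 - κ) * n) = (L : ℝ) ^ n * ((L : ℝ) ^ (-κ)) ^ n := by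
    intro n
    rw [← Real.rpow_mul_natCast hL0.le, ← Real.rpow_natCast, ← Real.rpow_add hL0]
    congr 1; ring
  set θ := (L : ℝ) ^ (-κ) with hθ
  have hθ0 : 0 < θ := Real.rpow_pos_of_pos hL0 _
  have hθ1 : θ < 1 := Real.rpow_lt_one_of_one_lt_of_neg hL (by linarith)
  have hWK : ∀ n, 1 ≤ n → ∀ x, |W n x / (L : ℝ) ^ (2 * n)| ≤ K * (n + 1) / (L : ℝ) ^ n := by
    intro n hn x
    refine le_of_tendsto ((hVW n x).div_const _).abs ?_
    filter_upwards [eventually_ge_atTop n] with N hN using hK N n hn hN x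
  have hK0 : 0 ≤ K := by
    have h1 := (abs_nonneg _).trans (hWK 1 le_rfl (cell L 1 0))
    have h2 : 0 ≤ K * ((1 : ℕ) + 1) := nonneg_of_mul_nonneg_left
      (by rwa [div_eq_mul_inv] at h1) (by positivity)
    norm_num at h2
    linarith
  have hsK : ∀ n : ℕ, 0 ≤ K * (n + 1) / (L : ℝ) ^ n := fun n => by positivity
  have hdW : ∀ n y, |cascade L W (n + 1) y - cascade L W n (anc L (n + 1) n y)|
      ≤ 64 * (K * ((n + 1 : ℕ) + 1) / (L : ℝ) ^ (n + 1)) := fun n y =>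
    (hW (n + 1)).abs_cascade_succ_sub_le' (by omega) (hsK _) (hWK (n + 1) (by omega)) y
  have hdV : ∀ N n, n < N → ∀ y,
      |cascade L (V N) (n + 1) y - cascade L (V N) n (anc L (n + 1) n y)|
      ≤ 64 * (K * ((n + 1 : ℕ) + 1) / (L : ℝ) ^ (n + 1)) := fun N n hn y =>
    (hV N).abs_cascade_succ_sub_le' hn (hsK _) (hK N (n + 1) (by omega) hn) y
  have hflS : ∀ n, ∀ z ∈ torus, torusFluct L (n + 1) uS z
      = cascade L W (n + 1) (cell L (n + 1) z) - cascade L W n (cell L n z) := by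
    intro n z hz
    rw [torusFluct_succ _ _ hz, torusAvg_torusLimit_cascade hW, torusAvg_torusLimit_cascade hW]
  set w : ℕ → (Fin 2 → ℝ) → ℝ := fun N y => step L N (cascade L (V N) N) y - uS y with hw
  have hflw : ∀ N n, ∀ z ∈ torus, torusFluct L (n + 1) (w N) z
      = torusFluct L (n + 1) (step L N (cascade L (V N) N)) z - torusFluct L (n + 1) uS z := by
    intro N n z hz
    rw [torusFluct_succ _ _ hz, torusFluct_succ _ _ hz, torusFluct_succ _ _ hz,
      torusAvg_sub (integrable_step _).integrableOn hint,
      torusAvg_sub (integrable_step _).integrableOn hint]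
    ring
  have hflN : ∀ N n, n < N → ∀ z ∈ torus,
      torusFluct L (n + 1) (step L N (cascade L (V N) N)) z
      = cascade L (V N) (n + 1) (cell L (n + 1) z) - cascade L (V N) n (cell L n z) := by
    intro N n hn z hz
    rw [torusFluct_succ _ _ hz, torusAvg_step_of_le hn, torusAvg_step_of_le hn.le,
      (hV N).latAvg_cascade hn le_rfl, (hV N).latAvg_cascade hn.le le_rfl]
  have hflN' : ∀ N n, N ≤ n → ∀ z ∈ torus,
      torusFluct L (n + 1) (step L N (cascade L (V N) N)) z = 0 := by
    intro N n hn z hz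
    rw [torusFluct_succ _ _ hz, torusAvg_step_of_ge (by omega), torusAvg_step_of_ge hn,
      anc_cell (by omega) hz, anc_cell hn hz, sub_self]
  -- uniform bounds on the fluctuations
  have hbS : ∀ n, ∀ z ∈ torus, |torusFluct L (n + 1) uS z|
      ≤ 64 * (K * ((n + 1 : ℕ) + 1) / (L : ℝ) ^ (n + 1)) := by
    intro n z hz
    rw [hflS n z hz, ← anc_cell (Nat.le_succ n) hz]
    exact hdW n _
  have hbw : ∀ N n, ∀ z ∈ torus, |torusFluct L (n + 1) (w N) z|
      ≤ 128 * (K * ((n + 1 : ℕ) + 1) / (L : ℝ) ^ (n + 1)) := by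
    intro N n z hz
    rw [hflw N n z hz]
    refine (abs_sub _ _).trans ?_
    have h1 := hbS n z hz
    rcases lt_or_ge n N with hn | hn
    · rw [hflN N n hn z hz, ← anc_cell (Nat.le_succ n) hz]
      have := hdV N n hn (cell L (n + 1) z)
      linarith
    · rw [hflN' N n hn z hz, abs_zero]
      linarith [hsK (n + 1)]
  -- they are small after weighting, on fine scales
  set τ : ℕ → ℝ := fun n => 128 * K * ((n + 1 : ℕ) + 1) * θ ^ (n + 1) with hτ
  have hτlim : Tendsto τ atTop (𝓝 0) := by
    have h1 : Tendsto (fun n : ℕ => 128 * K * ((n : ℝ) * θ ^ n + θ ^ n)) atTop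
        (𝓝 (128 * K * (0 + 0))) :=
      ((tendsto_self_mul_const_pow_of_lt_one hθ0.le hθ1).add
        (tendsto_pow_atTop_nhds_zero_of_lt_one hθ0.le hθ1)).const_mul _
    rw [add_zero, mul_zero] at h1
    refine (h1.comp (tendsto_add_atTop_nat 1)).congr fun n => ?_
    simp only [Function.comp, hτ]
    ring
  have hweight : ∀ n : ℕ, ∀ t ≤ 128 * (K * ((n + 1 : ℕ) + 1) / (L : ℝ) ^ (n + 1)),
      (L : ℝ) ^ ((1 - κ) * (n + 1 : ℕ)) * t ≤ τ n := by
    intro n t ht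
    rw [hpow]
    refine (mul_le_mul_of_nonneg_left ht (by positivity)).trans (le_of_eq ?_)
    simp only [hτ]
    field_simp
  have hconv : Tendsto (fun N => besovNorm L (1 - κ) (w N)) atTop (𝓝 0) := by
    rw [ENNReal.tendsto_atTop_zero]
    intro ε' hε'
    obtain ⟨ε, hε, hεε⟩ : ∃ ε : ℝ, 0 < ε ∧ ENNReal.ofReal ε + ENNReal.ofReal ε ≤ ε' := by
      rcases eq_or_ne ε' ∞ with rfl | hne
      · exact ⟨1, one_pos, le_top⟩
      · have : 0 < ε'.toReal := ENNReal.toReal_pos hε'.ne' hne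
        refine ⟨ε'.toReal / 2, by positivity, ?_⟩
        rw [← ENNReal.ofReal_add (by positivity) (by positivity), add_halves,
          ENNReal.ofReal_toReal hne]
    obtain ⟨m, hm⟩ := eventually_atTop.1 (hτlim.eventually (ge_mem_nhds hε))
    set η := ε / (2 * (L : ℝ) ^ (m + 1)) with hη
    have hη0 : 0 < η := by positivity
    have hηε : 2 * (L : ℝ) ^ (m + 1) * η = ε := by rw [hη]; field_simp
    have hev : ∀ᶠ N in atTop, ∀ n ∈ Finset.range (m + 1), ∀ x : Lat L n,
        |cascade L (V N) n x - cascade L W n x| ≤ η := by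
      refine (Finset.eventually_all _).2 fun n _ => eventually_all.2 fun x => ?_
      have := tendsto_cascade hW hVW n x
      exact (Metric.tendsto_nhds.1 this η hη0).mono fun N hN => by
        rw [Real.dist_eq] at hN; exact hN.le
    obtain ⟨N₀, hN₀⟩ := eventually_atTop.1 hev
    refine ⟨max N₀ (m + 1), fun N hN => (besovNorm_le (A := ε) (B := ε) ?_ ?_).trans hεε⟩
    · have := hN₀ N (le_trans (le_max_left _ _) hN) 0 (by simp) (cell L 0 0)
      rw [integral_torus_eq (L := L) _ (cell L 0 0),
        torusAvg_sub (integrable_step _).integrableOn hint, torusAvg_torusLimit_cascade hW,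
        torusAvg_step_of_le (Nat.zero_le N), (hV N).latAvg_cascade (Nat.zero_le N) le_rfl]
      refine this.trans ?_
      have : 1 ≤ (L : ℝ) ^ (m + 1) := one_le_pow₀ hL.le
      nlinarith
    · intro n z hz
      rcases lt_or_ge n m with hn | hn
      · have hNm : m + 1 ≤ N := le_trans (le_max_right _ _) hN
        have h1 := hN₀ N (le_trans (le_max_left _ _) hN) (n + 1) (by simp; omega)
          (cell L (n + 1) z)
        have h2 := hN₀ N (le_trans (le_max_left _ _) hN) n (by simp; omega) (cell L n z)
        have h3 : |torusFluct L (n + 1) (w N) z| ≤ 2 * η := by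
          rw [hflw N n z hz, hflN N n (by omega) z hz, hflS n z hz]
          rw [abs_le] at *
          constructor <;> linarith
        have h4 : (L : ℝ) ^ ((1 - κ) * (n + 1 : ℕ)) ≤ (L : ℝ) ^ (m + 1) := by
          rw [← Real.rpow_natCast (L : ℝ) (m + 1)]
          refine Real.rpow_le_rpow_of_exponent_le hL.le ?_
          have : ((n + 1 : ℕ) : ℝ) ≤ ((m + 1 : ℕ) : ℝ) := by exact_mod_cast (by omega)
          have : (0 : ℝ) ≤ ((n + 1 : ℕ) : ℝ) := Nat.cast_nonneg _
          nlinarith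
        calc _ ≤ (L : ℝ) ^ (m + 1) * (2 * η) := mul_le_mul h4 h3 (abs_nonneg _) (by positivity)
          _ = ε := by linarith
      · exact (hweight n _ (hbw N n z hz)).trans (hm n hn)
  refine ⟨⟨hint, ?_, ?_⟩, hconv⟩
  · obtain ⟨B, hB⟩ := hτlim.bddAbove_range
    refine (besovNorm_le (A := 16) (B := B) ?_ fun n z hz => ?_).trans_lt
      (ENNReal.add_lt_top.2 ⟨ENNReal.ofReal_lt_top, ENNReal.ofReal_lt_top⟩)
    · rw [integral_torus_eq (L := L) _ (cell L 0 0), torusAvg_torusLimit_cascade hW]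
      exact (hW 0).abs_cascade_le le_rfl _
    · refine (hweight n _ ((hbS n z hz).trans ?_)).trans (hB ⟨n, rfl⟩)
      linarith [hsK (n + 1)]
  · intro ε hε
    obtain ⟨N, hN⟩ := (hconv.eventually (gt_mem_nhds hε)).exists
    refine ⟨N, cascade L (V N) N, ?_⟩
    rwa [besovNorm_sub_comm]

end Limit

/-! ### Convergence of the solutions for a regular realisation of the noise -/

section Deterministic

variable {L : ℕ} [NeZero L] {r g b : ℝ} {ζ : ∀ n, Lat L n → ℝ}

/-- If the noise grows at most linearly in the scale, the effective potentials decay faster than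
any power of `L⁻ⁿ` with exponent below one. -/
lemma IsRegular.abs_effPot_le_of_growth (h : IsRegular L r g b ζ) {K : ℝ}
    (hK : ∀ n x, |ζ n x| ≤ K * (n + 1)) (k n : ℕ) (x : Lat L n) :
    |effPot L r g ζ k n x / (L : ℝ) ^ (2 * n)| ≤ (K + 3 * r) * (n + 1) / (L : ℝ) ^ n := by
  have hL := h.L_pos
  have hb := h.one_le_b
  have hr := h.one_le_r
  have hLn : (0 : ℝ) < (L : ℝ) ^ n := by positivity
  have h1 := (h.small_of_approx (h.effPot_approx k n x)).1
  have h2 : |g * ζ n x / (L : ℝ) ^ n| ≤ K * (n + 1) / (L : ℝ) ^ n := by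
    rw [abs_div, abs_of_pos hLn]
    refine div_le_div_of_nonneg_right ?_ hLn.le
    rw [abs_mul, abs_of_pos h.g_pos]
    nlinarith [hK n x, abs_nonneg (ζ n x), h.g_le_one]
  have h3 : 3 * r * (2 * b ^ 2) ^ n / (L : ℝ) ^ (2 * n) ≤ 3 * r * (n + 1) / (L : ℝ) ^ n := by
    have e : 3 * r * (2 * b ^ 2) ^ n / (L : ℝ) ^ (2 * n)
        = 3 * r * (2 * b ^ 2 / L) ^ n / (L : ℝ) ^ n := by
      rw [pow_mul' (L : ℝ), div_pow]; field_simp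
    rw [e]
    refine div_le_div_of_nonneg_right (mul_le_mul_of_nonneg_left ?_ (by linarith)) hLn.le
    have : 2 * b ^ 2 / L ≤ 1 := by
      rw [div_le_one hL]
      have := h.le_L
      have : b ^ 2 ≤ b ^ 3 := pow_le_pow_right₀ hb (by norm_num)
      have : 1 ≤ b ^ 2 := one_le_pow₀ hb
      nlinarith
    have h5 : (2 * b ^ 2 / L) ^ n ≤ 1 := pow_le_one₀ (by positivity) this
    have : (0 : ℝ) ≤ n := Nat.cast_nonneg n
    linarith
  have e : effPot L r g ζ k n x / (L : ℝ) ^ (2 * n)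
      = (effPot L r g ζ k n x / (L : ℝ) ^ (2 * n) - g * ζ n x / (L : ℝ) ^ n)
        + g * ζ n x / (L : ℝ) ^ n := by ring
  rw [e]
  refine (abs_add_le _ _).trans ?_
  rw [add_mul, add_div]
  linarith

/-- For a regular realisation of the noise whose second chaos converges, the equation is uniquely
solvable for every cutoff and the solutions converge. -/
theorem IsRegular.exists_solution (h : IsRegular L r g b ζ)
    (hX : ∀ n x, ∃ l, Tendsto (fun k => chaos L ζ k n x) atTop (𝓝 l))
    (hK : ∃ K : ℝ, ∀ n x, |ζ n x| ≤ K * (n + 1)) :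
    ∃ u : (N : ℕ) → Lat L N → ℝ,
      (∀ N, (∀ x, negLaplacian L N (u N) x = effPot L r g ζ 0 N x * u N x + 1) ∧
        ∀ v : Lat L N → ℝ, (∀ x, negLaplacian L N v x = effPot L r g ζ 0 N x * v x + 1) →
          v = u N) ∧
      ∃ uStar : (Fin 2 → ℝ) → ℝ, ∀ κ : ℝ, 0 < κ → κ < 1 →
        MemBesov L (1 - κ) uStar ∧
        Tendsto (fun N => besovNorm L (1 - κ) (fun y => step L N (u N) y - uStar y))
          atTop (𝓝 0) := by
  obtain ⟨K, hK⟩ := hK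
  choose W hW using fun n x => h.exists_tendsto_effPot hX n x
  have hL1 : 1 < (L : ℝ) := by
    have : 1 ≤ b ^ 3 := one_le_pow₀ h.one_le_b
    nlinarith [h.le_L, h.one_le_r]
  set V : ℕ → ∀ n, Lat L n → ℝ := fun N n => effPot L r g ζ (N - n) n with hV
  have hVN : ∀ N, V N N = effPot L r g ζ 0 N := fun N => by simp only [hV, Nat.sub_self]
  refine ⟨fun N => cascade L (V N) N, fun N => ⟨fun x => ?_, fun v hv => ?_⟩,
    torusLimit L (cascade L W), fun κ h0 h1 => ?_⟩
  · rw [← hVN]; exact (h.isPotential N).negLaplacian_cascade x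
  · rw [← hVN] at hv; exact (h.isPotential N).eq_cascade hv
  · exact memBesov_and_tendsto_of_potentials (fun N => h.isPotential_of_tendsto hW N) hL1
      h.isPotential hW (K := K + 3 * r) (fun N n _ _ x => h.abs_effPot_le_of_growth hK _ n x) h0 h1

end Deterministic

/-! ### The second chaos in terms of block averages of Wick squares -/

section Chaos

variable {L : ℕ} [NeZero L] {ζ : ∀ n, Lat L n → ℝ}

/-- The average of the Wick squares `ζ² - 1` of the unit noise at scale `j` over a box of scale
`n ≤ j`. -/
def wickAvg (L : ℕ) (ζ : ∀ n, Lat L n → ℝ) (n : ℕ) (x : Lat L n) (j : ℕ) : ℝ :=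
  latAvg L j n (fun y => ζ j y ^ 2 - 1) x

lemma chaos_eq_sum (k n : ℕ) (x : Lat L n) :
    chaos L ζ k n x = ∑ i ∈ Finset.range k,
      (wickAvg L ζ n x (n + (i + 1)) - ((L : ℝ) ^ 2)⁻¹ * wickAvg L ζ n x (n + i)) := by
  induction k generalizing n with
  | zero => simp [chaos]
  | succ k ih =>
    rw [chaos, funext (ih (n + 1)), latAvg_sum, Finset.sum_range_succ']
    congr 1
    · refine Finset.sum_congr rfl fun i _ => ?_
      rw [latAvg_sub, latAvg_const_mul]
      have e : ∀ j, n + 1 ≤ j → latAvg L (n + 1) n (fun y => wickAvg L ζ (n + 1) y j) x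
          = wickAvg L ζ n x j := fun j hj => latAvg_latAvg (Nat.le_succ n) hj _ x
      rw [e _ (by omega), e _ (by omega), show n + 1 + (i + 1) = n + (i + 1 + 1) by omega,
        show n + 1 + i = n + (i + 1) by omega]
    · have h1 : wickAvg L ζ n x (n + 0) = ζ n x ^ 2 - 1 := congrFun (latAvg_self _) x
      have h2 : wickAvg L ζ n x (n + (0 + 1))
          = latAvg L (n + 1) n (fun y => ζ (n + 1) y ^ 2) x - 1 := by
        rw [wickAvg, zero_add, latAvg_sub, latAvg_const (Nat.le_succ n)]
      rw [h1, h2]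
      ring

/-- If the averages of the Wick squares decay geometrically in the scale, the second chaos is
bounded uniformly in the cutoff. -/
lemma abs_chaos_le (hL : 3 ≤ L) {n : ℕ} {x : Lat L n} {lam : ℝ} (hlam : 0 ≤ lam)
    (h : ∀ i, |wickAvg L ζ n x (n + i)| ≤ lam * (1 / 2) ^ i / 4) (k : ℕ) :
    |chaos L ζ k n x| ≤ lam := by
  have hL3 : (3 : ℝ) ≤ L := by exact_mod_cast hL
  have hLinv : ((L : ℝ) ^ 2)⁻¹ ≤ 1 := inv_le_one_of_one_le₀ (one_le_pow₀ (by linarith))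
  have hLinv0 : 0 ≤ ((L : ℝ) ^ 2)⁻¹ := by positivity
  rw [chaos_eq_sum]
  refine (Finset.abs_sum_le_sum_abs _ _).trans ?_
  have hk : ∀ i ∈ Finset.range k,
      |wickAvg L ζ n x (n + (i + 1)) - ((L : ℝ) ^ 2)⁻¹ * wickAvg L ζ n x (n + i)|
        ≤ (3 / 8 * lam) * (1 / 2) ^ i := by
    intro i _
    refine (abs_sub _ _).trans ?_
    rw [abs_mul, abs_of_nonneg hLinv0]
    have h1 := h (i + 1)
    have h2 := h i
    rw [pow_succ] at h1
    have h3 : ((L : ℝ) ^ 2)⁻¹ * |wickAvg L ζ n x (n + i)| ≤ |wickAvg L ζ n x (n + i)| :=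
      mul_le_of_le_one_left (abs_nonneg _) hLinv
    linarith
  refine (Finset.sum_le_sum hk).trans ?_
  rw [← Finset.mul_sum]
  have : ∑ i ∈ Finset.range k, (1 / 2 : ℝ) ^ i ≤ 2 := sum_geometric_two_le k
  nlinarith

/-- Summability of the averages of the Wick squares over the scales makes the second chaos converge
as the cutoff is removed. -/
lemma exists_tendsto_chaos {n : ℕ} {x : Lat L n}
    (h : ∀ᶠ i in atTop, |wickAvg L ζ n x (n + i)| ≤ (1 / 2) ^ i) :
    ∃ l, Tendsto (fun k => chaos L ζ k n x) atTop (𝓝 l) := by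
  have hs : Summable fun i => wickAvg L ζ n x (n + i) :=
    Summable.of_norm_bounded_eventually_nat summable_geometric_two h
  have hs' : Summable fun i =>
      wickAvg L ζ n x (n + (i + 1)) - ((L : ℝ) ^ 2)⁻¹ * wickAvg L ζ n x (n + i) :=
    ((summable_nat_add_iff 1).2 hs).sub (hs.mul_left _)
  refine ⟨_, hs'.hasSum.tendsto_sum_nat.congr fun k => ?_⟩
  rw [chaos_eq_sum]

/-- The coarse averages of a consistent noise. -/
lemma latAvg_of_consistent (hc : ∀ n x, latAvg L (n + 1) n (ζ (n + 1)) x = ζ n x / L)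
    {n N : ℕ} (h : n ≤ N) (x : Lat L n) :
    latAvg L N n (ζ N) x = ζ n x / (L : ℝ) ^ (N - n) := by
  have hL := L_pos (L := L)
  induction h using Nat.decreasingInduction with
  | self => simp [latAvg_self]
  | of_succ j hj ih =>
    rw [← latAvg_latAvg (Nat.le_succ j) hj, funext ih]
    have e : (fun x => ζ (j + 1) x / (L : ℝ) ^ (N - (j + 1)))
        = fun x => ((L : ℝ) ^ (N - (j + 1)))⁻¹ * ζ (j + 1) x := by
      funext y; rw [div_eq_inv_mul]
    rw [e, latAvg_const_mul, hc, show N - j = N - (j + 1) + 1 by omega, pow_succ]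
    field_simp

omit [NeZero L] in
lemma propagator_self (N : ℕ) (f : Lat L N → ℝ) (x : Lat L N) : propagator L N N f x = 0 := by
  simp [propagator]

lemma propagator_of_lt {n N : ℕ} (h : n < N) (f : Lat L N → ℝ) (x : Lat L N) :
    propagator L N n f x = propagator L N (n + 1) f x + (L : ℝ) ^ (2 * (N - (n + 1))) *
      (latAvg L N (n + 1) f (anc L N (n + 1) x) - latAvg L N n f (anc L N n x)) := by
  rw [propagator, propagator, show N - n = (N - (n + 1)) + 1 by omega,
    Finset.sum_Icc_succ_top (by omega)]
  congr 1
  rw [show N - (N - (n + 1) + 1) + 1 = n + 1 by omega, latFluct_apply]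
  rfl

/-- The definition of the second chaos through the propagator agrees with the recursion over the
scales. -/
lemma latAvg_mul_propagator
    (hc : ∀ n x, latAvg L (n + 1) n (ζ (n + 1)) x = ζ n x / L) {n N : ℕ} (h : n ≤ N)
    (x : Lat L n) :
    latAvg L N n (fun y => ζ N y * propagator L N n (ζ N) y
      - (N - n : ℕ) * (1 - ((L : ℝ) ^ 2)⁻¹)) x = chaos L ζ (N - n) n x := by
  have hL := L_pos (L := L)
  induction h using Nat.decreasingInduction with
  | self => simp [propagator_self, chaos, latAvg]
  | of_succ j hj ih =>
    have hd : N - j = N - (j + 1) + 1 := by omega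
    rw [hd, chaos, ← funext ih, latAvg_latAvg (Nat.le_succ j) hj]
    have e : (fun y => ζ N y * propagator L N j (ζ N) y
          - ((N - (j + 1) + 1 : ℕ) : ℝ) * (1 - ((L : ℝ) ^ 2)⁻¹))
        = fun y => (ζ N y * propagator L N (j + 1) (ζ N) y
            - (N - (j + 1) : ℕ) * (1 - ((L : ℝ) ^ 2)⁻¹))
          + (((L : ℝ) ^ (N - (j + 1)) * (ζ (j + 1) (anc L N (j + 1) y) * ζ N y)
              - (L : ℝ) ^ (N - (j + 1)) / L * (ζ j (anc L N j y) * ζ N y))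
            - (1 - ((L : ℝ) ^ 2)⁻¹)) := by
      funext y
      rw [propagator_of_lt hj, latAvg_of_consistent hc hj, latAvg_of_consistent hc hj.le, hd,
        pow_mul' (L : ℝ), pow_succ]
      push_cast
      field_simp
      ring
    rw [e, latAvg_add]
    congr 1
    rw [latAvg_sub, latAvg_const hj.le, latAvg_sub, latAvg_const_mul, latAvg_const_mul,
      latAvg_anc_mul (ζ j), latAvg_of_consistent hc hj.le,
      ← latAvg_latAvg (Nat.le_succ j) hj (fun y => ζ (j + 1) (anc L N (j + 1) y) * ζ N y)]
    have e2 : latAvg L N (j + 1) (fun y => ζ (j + 1) (anc L N (j + 1) y) * ζ N y)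
        = fun y => ((L : ℝ) ^ (N - (j + 1)))⁻¹ * ζ (j + 1) y ^ 2 := by
      funext y
      rw [latAvg_anc_mul (ζ (j + 1)), latAvg_of_consistent hc hj]
      ring
    rw [e2, latAvg_const_mul, hd, pow_succ]
    field_simp

end Chaos

/-! ### Tail bounds for averages of Wick squares -/

section Tail

lemma exp_neg_le_sqrt_one_sub {t : ℝ} (ht : |t| ≤ 1 / 4) :
    Real.exp (-t) ≤ √(1 - 2 * t) * Real.exp (4 * t ^ 2) := by
  obtain ⟨h1, h2⟩ := abs_le.1 ht
  have hpos : 0 < 1 - 2 * t := by linarith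
  have h := Real.abs_log_sub_add_sum_range_le (x := 2 * t)
    (by rw [abs_mul, abs_two]; linarith) 1
  simp only [Finset.range_one, Finset.sum_singleton, zero_add, pow_one, Nat.cast_zero, div_one,
    Nat.reduceAdd, sq_abs] at h
  have h3 : (2 * t) ^ 2 / (1 - |2 * t|) ≤ 8 * t ^ 2 := by
    have : 1 / 2 ≤ 1 - |2 * t| := by rw [abs_mul, abs_two]; linarith
    rw [div_le_iff₀ (by linarith)]
    nlinarith [sq_nonneg t]
  have h4 := (abs_le.1 (h.trans h3)).1
  rw [Real.sqrt_eq_rpow, Real.rpow_def_of_pos hpos, ← Real.exp_add, Real.exp_le_exp]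
  linarith

lemma integral_exp_wick_gaussian {t : ℝ} (ht : |t| ≤ 1 / 4) :
    ∫ x, Real.exp (t * (x ^ 2 - 1)) ∂(gaussianReal 0 1) = Real.exp (-t) / √(1 - 2 * t) := by
  obtain ⟨h1, h2⟩ := abs_le.1 ht
  have hpos : 0 < 1 - 2 * t := by linarith
  rw [integral_gaussianReal_eq_integral_smul (by norm_num)]
  have e : ∀ x : ℝ, gaussianPDFReal 0 1 x • Real.exp (t * (x ^ 2 - 1))
      = (Real.exp (-t) * (√(2 * Real.pi))⁻¹) * Real.exp (-((1 - 2 * t) / 2) * x ^ 2) := by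
    intro x
    rw [gaussianPDFReal, smul_eq_mul]
    simp only [NNReal.coe_one, mul_one, sub_zero]
    rw [mul_assoc, ← Real.exp_add, mul_comm (Real.exp (-t)), mul_assoc, ← Real.exp_add]
    congr 2
    ring
  simp_rw [e]
  rw [integral_const_mul, integral_gaussian]
  have : √(Real.pi / ((1 - 2 * t) / 2)) = √(2 * Real.pi) / √(1 - 2 * t) := by
    rw [← Real.sqrt_div (by positivity)]
    congr 1
    field_simp
  rw [this]
  have h3 : √(2 * Real.pi) ≠ 0 := by positivity
  have h4 : √(1 - 2 * t) ≠ 0 := by positivity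
  field_simp

variable {Ω : Type*} [MeasurableSpace Ω] {P : Measure Ω}

lemma mgf_wick {Z : Ω → ℝ} (hZ : P.map Z = gaussianReal 0 1) (hm : AEMeasurable Z P) {t : ℝ}
    (ht : |t| ≤ 1 / 4) :
    mgf (fun ω => Z ω ^ 2 - 1) P t = Real.exp (-t) / √(1 - 2 * t) := by
  rw [← integral_exp_wick_gaussian ht, ← hZ, integral_map hm (by fun_prop)]
  rfl

variable {ι : Type*} {Z : ι → Ω → ℝ}

lemma sum_wick_mgf (hi : iIndepFun Z P) (hZ : ∀ i, P.map (Z i) = gaussianReal 0 1)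
    (hm : ∀ i, AEMeasurable (Z i) P) (s : Finset ι) {t : ℝ} (ht : |t| ≤ 1 / 4) :
    Integrable (fun ω => Real.exp (t * (∑ i ∈ s, fun ω => Z i ω ^ 2 - 1) ω)) P ∧
      mgf (∑ i ∈ s, fun ω => Z i ω ^ 2 - 1) P t ≤ Real.exp (4 * t ^ 2 * s.card) := by
  have hpos : 0 < 1 - 2 * t := by linarith [(abs_le.1 ht).2]
  have hind : iIndepFun (fun i ω => Z i ω ^ 2 - 1) P :=
    hi.comp (fun _ x => x ^ 2 - 1) fun _ => by fun_prop
  have e : mgf (∑ i ∈ s, fun ω => Z i ω ^ 2 - 1) P t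
      = (Real.exp (-t) / √(1 - 2 * t)) ^ s.card := by
    rw [hind.mgf_sum₀ (fun i => ((hm i).pow_const 2).sub_const 1), Finset.prod_congr rfl
      fun i _ => mgf_wick (hZ i) (hm i) ht, Finset.prod_const]
  refine ⟨?_, ?_⟩
  · by_contra hni
    have h0 := mgf_undef hni
    rw [e] at h0
    have : 0 < (Real.exp (-t) / √(1 - 2 * t)) ^ s.card := by positivity
    linarith
  · rw [e, mul_comm _ (s.card : ℝ), Real.exp_nat_mul]
    refine pow_le_pow_left₀ (by positivity) ?_ _
    rw [div_le_iff₀ (by positivity), mul_comm]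
    exact exp_neg_le_sqrt_one_sub ht

lemma exp_quarter_le : Real.exp (1 / 4) ≤ 3 / 2 := by
  have h := Real.exp_bound_div_one_sub_of_interval (x := 1 / 4) (by norm_num) (by norm_num)
  linarith

/-- The average of `ℓ²` independent Wick squares has exponential tails on the scale `1 / ℓ`. -/
lemma measureReal_wick_avg_le [IsProbabilityMeasure P] (hi : iIndepFun Z P)
    (hZ : ∀ i, P.map (Z i) = gaussianReal 0 1) (hm : ∀ i, AEMeasurable (Z i) P) (s : Finset ι)
    {l : ℝ} (hl : 1 ≤ l) (hs : (s.card : ℝ) = l ^ 2) (a : ℝ) :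
    P.real {ω | a < |(l ^ 2)⁻¹ * ∑ i ∈ s, (Z i ω ^ 2 - 1)|} ≤ 3 * Real.exp (-(l * a / 4)) := by
  set S : Ω → ℝ := ∑ i ∈ s, fun ω => Z i ω ^ 2 - 1 with hS
  have hSω : ∀ ω, ∑ i ∈ s, (Z i ω ^ 2 - 1) = S ω := fun ω => by simp [hS]
  have hl2 : 0 < l ^ 2 := by positivity
  set t := 1 / (4 * l) with ht
  have ht0 : 0 < t := by positivity
  have ht4 : t ≤ 1 / 4 := by
    rw [ht]; exact one_div_le_one_div_of_le (by norm_num) (by linarith)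
  have htl : t * l ^ 2 = l / 4 := by rw [ht]; field_simp
  have ht2 : 4 * t ^ 2 * (s.card : ℝ) = 1 / 4 := by rw [hs, ht]; field_simp
  obtain ⟨i1, m1⟩ := sum_wick_mgf hi hZ hm s (t := t) (by rw [abs_of_pos ht0]; exact ht4)
  obtain ⟨i2, m2⟩ := sum_wick_mgf hi hZ hm s (t := -t)
    (by rw [abs_neg, abs_of_pos ht0]; exact ht4)
  rw [neg_sq, ht2] at m2
  rw [ht2] at m1
  have c1 := measure_ge_le_exp_mul_mgf (l ^ 2 * a) ht0.le i1
  have c2 := measure_le_le_exp_mul_mgf (-(l ^ 2 * a)) (neg_nonpos.2 ht0.le) i2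
  have hsub : {ω | a < |(l ^ 2)⁻¹ * ∑ i ∈ s, (Z i ω ^ 2 - 1)|}
      ⊆ {ω | l ^ 2 * a ≤ S ω} ∪ {ω | S ω ≤ -(l ^ 2 * a)} := by
    intro ω hω
    simp only [mem_ofPred_eq, hSω, abs_mul, abs_inv, abs_of_pos hl2] at hω
    rw [← div_eq_inv_mul, lt_div_iff₀ hl2, mul_comm, lt_abs] at hω
    rcases hω with h | h
    · exact Or.inl h.le
    · exact Or.inr (show S ω ≤ _ by linarith)
  refine (measureReal_mono hsub).trans ((measureReal_union_le _ _).trans ?_)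
  have e1 : -t * (l ^ 2 * a) = -(l * a / 4) := by
    have : -t * (l ^ 2 * a) = -(t * l ^ 2 * a) := by ring
    rw [this, htl]; ring
  have e2 : - -t * (-(l ^ 2 * a)) = -(l * a / 4) := by rw [← e1]; ring
  rw [e1] at c1
  rw [e2] at c2
  have hE := Real.exp_pos (-(l * a / 4))
  have b1 := mul_le_mul_of_nonneg_left (m1.trans exp_quarter_le) hE.le
  have b2 := mul_le_mul_of_nonneg_left (m2.trans exp_quarter_le) hE.le
  linarith

end Tail

/-! ### The lattice noise: independence, consistency and tails -/

section WhiteNoise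

variable {Ω : Type*} [MeasurableSpace Ω] {P : Measure Ω} {ξ : Lp ℝ 2 torusMeasure → Ω → ℝ}

namespace IsWhiteNoise

variable (hξ : IsWhiteNoise ξ P)
include hξ

lemma memLp (f : Lp ℝ 2 torusMeasure) : MemLp (ξ f) 2 P :=
  (hξ.gaussian.hasGaussianLaw_eval f).memLp_two

lemma integrable_mul (f h : Lp ℝ 2 torusMeasure) : Integrable (fun ω => ξ f ω * ξ h ω) P :=
  (hξ.memLp f).integrable_mul (hξ.memLp h)

/-- White noise is almost surely additive on any given finite family. -/
lemma ae_eq_sum {ι : Type*} (s : Finset ι) (f : ι → Lp ℝ 2 torusMeasure) :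
    ∀ᵐ ω ∂P, ξ (∑ i ∈ s, f i) ω = ∑ i ∈ s, ξ (f i) ω := by
  set F := ∑ i ∈ s, f i with hF
  set D : Ω → ℝ := fun ω => ξ F ω - ∑ i ∈ s, ξ (f i) ω with hD
  have hh : ∀ h : Lp ℝ 2 torusMeasure, Integrable (fun ω => ξ h ω * D ω) P ∧
      ∫ ω, ξ h ω * D ω ∂P = 0 := by
    intro h
    have e : (fun ω => ξ h ω * D ω)
        = fun ω => ξ h ω * ξ F ω - ∑ i ∈ s, ξ h ω * ξ (f i) ω := by
      funext ω; simp only [hD, mul_sub, Finset.mul_sum]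
    have i1 := hξ.integrable_mul h F
    have i2 : Integrable (fun ω => ∑ i ∈ s, ξ h ω * ξ (f i) ω) P :=
      integrable_finsetSum _ fun i _ => hξ.integrable_mul h (f i)
    rw [e]
    refine ⟨i1.sub i2, ?_⟩
    rw [integral_sub i1 i2, integral_finsetSum _ fun i _ => hξ.integrable_mul h (f i),
      hξ.covariance, Finset.sum_congr rfl fun i _ => hξ.covariance h (f i), hF, inner_sum, sub_self]
  have e : (fun ω => D ω ^ 2) = fun ω => ξ F ω * D ω - ∑ i ∈ s, ξ (f i) ω * D ω := by
    funext ω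
    rw [← Finset.sum_mul, ← sub_mul, sq]
  have i2 : Integrable (fun ω => ∑ i ∈ s, ξ (f i) ω * D ω) P :=
    integrable_finsetSum _ fun i _ => (hh (f i)).1
  have hint : Integrable (fun ω => D ω ^ 2) P := by rw [e]; exact (hh F).1.sub i2
  have hzero : ∫ ω, D ω ^ 2 ∂P = 0 := by
    rw [e, integral_sub (hh F).1 i2, integral_finsetSum _ fun i _ => (hh (f i)).1, (hh F).2,
      Finset.sum_congr rfl fun i _ => (hh (f i)).2]
    simp
  rw [integral_eq_zero_iff_of_nonneg (fun ω => sq_nonneg (D ω)) hint] at hzero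
  filter_upwards [hzero] with ω hω
  have : D ω = 0 := by simpa using hω
  simp only [hD] at this
  linarith

end IsWhiteNoise

variable {L : ℕ}

omit [MeasurableSpace Ω] in
lemma unitNoise_eq [NeZero L] (n : ℕ) (ω : Ω) (x : Lat L n) :
    unitNoise ξ L n ω x = (L : ℝ) ^ n * ξ (boxInd L n x) ω := by
  have hL := L_pos (L := L)
  rw [unitNoise, latNoise, pow_mul']
  field_simp

omit [MeasurableSpace Ω] in
lemma latNoise_eq [NeZero L] (n : ℕ) (ω : Ω) (x : Lat L n) :
    latNoise ξ L n ω x = (L : ℝ) ^ n * unitNoise ξ L n ω x := by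
  have hL := L_pos (L := L)
  rw [unitNoise]
  field_simp

open scoped Classical in
lemma boxInd_eq_sum [NeZero L] {n N : ℕ} (h : n ≤ N) (x : Lat L n) :
    boxInd L n x = ∑ y : Lat L N with anc L N n y = x, boxInd L N y := by
  apply Lp.ext
  have h1 : ∀ᵐ z ∂torusMeasure, ∀ y : Lat L N,
      boxInd L N y z = (box L N y).indicator (fun _ => (1 : ℝ)) z :=
    ae_all_iff.2 fun y => indicatorConstLp_coeFn
  have h2 : ∀ᵐ z ∂torusMeasure, boxInd L n x z = (box L n x).indicator (fun _ => (1 : ℝ)) z :=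
    indicatorConstLp_coeFn
  have h3 := Lp.coeFn_finsetSum (Finset.univ.filter fun y : Lat L N => anc L N n y = x)
    (fun y => boxInd L N y)
  filter_upwards [h1, h2, h3] with z k1 k2 k3
  rw [k2, k3, Finset.sum_apply, indicator_box_eq_sum h x 1 z]
  simp only [pt_mem_box_iff, k1]

lemma inner_boxInd [NeZero L] {n : ℕ} (x y : Lat L n) :
    inner ℝ (boxInd L n x) (boxInd L n y) = if x = y then ((L : ℝ) ^ (2 * n))⁻¹ else 0 := by
  have hL := L_pos (L := L)
  rw [boxInd, boxInd, L2.real_inner_indicatorConstLp_one_indicatorConstLp_one _ _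
    (torusMeasure_ne_top _) (torusMeasure_ne_top _)]
  split_ifs with h
  · subst h
    rw [inter_self, measureReal_def, torusMeasure_box, ← measureReal_def, volume_real_box]
  · have : box L n x ∩ box L n y = ∅ := by
      rw [eq_empty_iff_forall_notMem]
      rintro z ⟨hz1, hz2⟩
      have hz := box_subset_torus y hz2
      rw [mem_box_iff_cell hz] at hz1 hz2
      exact h (hz1.symm.trans hz2)
    rw [this]
    simp

namespace IsWhiteNoise

variable [NeZero L] (hξ : IsWhiteNoise ξ P)
include hξ

lemma memLp_unitNoise (n : ℕ) (x : Lat L n) : MemLp (fun ω => unitNoise ξ L n ω x) 2 P := by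
  simp only [unitNoise_eq]
  exact (hξ.memLp _).const_mul _

lemma integral_unitNoise_mul {n : ℕ} (x y : Lat L n) :
    ∫ ω, unitNoise ξ L n ω x * unitNoise ξ L n ω y ∂P = if x = y then 1 else 0 := by
  have hL := L_pos (L := L)
  simp only [unitNoise_eq]
  have e : (fun ω => (L : ℝ) ^ n * ξ (boxInd L n x) ω * ((L : ℝ) ^ n * ξ (boxInd L n y) ω))
      = fun ω => (L : ℝ) ^ (2 * n) * (ξ (boxInd L n x) ω * ξ (boxInd L n y) ω) := by
    funext ω; rw [pow_mul' (L : ℝ)]; ring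
  rw [e, integral_const_mul, hξ.covariance, inner_boxInd]
  split_ifs
  · field_simp
  · simp

lemma integral_unitNoise (n : ℕ) (x : Lat L n) : ∫ ω, unitNoise ξ L n ω x ∂P = 0 := by
  simp only [unitNoise_eq]
  rw [integral_const_mul, hξ.mean_zero, mul_zero]

lemma hasGaussianLaw_unitNoise (n : ℕ) : HasGaussianLaw (fun ω x => unitNoise ξ L n ω x) P := by
  have h1 := ((hξ.gaussian.comp_right (boxInd L n)).smul fun _ => (L : ℝ) ^ n).hasGaussianLaw
    Finset.univ
  have h2 := h1.map_fun (ContinuousLinearMap.pi fun x : Lat L n =>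
    ContinuousLinearMap.proj (R := ℝ) (φ := fun _ : (Finset.univ : Finset (Lat L n)) => ℝ)
      ⟨x, Finset.mem_univ x⟩)
  convert! h2 using 1
  funext ω x
  simp [unitNoise_eq]

variable [IsProbabilityMeasure P]

omit [IsProbabilityMeasure P] in
lemma map_unitNoise {n : ℕ} (x : Lat L n) :
    P.map (fun ω => unitNoise ξ L n ω x) = gaussianReal 0 1 := by
  have h := ((hξ.hasGaussianLaw_unitNoise n).eval x).map_eq_gaussianReal
  have hv : Var[fun ω => unitNoise ξ L n ω x; P] = 1 := by
    rw [variance_of_integral_eq_zero (hξ.memLp_unitNoise n x).aemeasurable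
      (hξ.integral_unitNoise n x)]
    have := hξ.integral_unitNoise_mul x x
    simp only [if_true] at this
    simpa only [sq] using this
  rw [h, hξ.integral_unitNoise n x, hv, Real.toNNReal_one]

lemma iIndepFun_unitNoise (n : ℕ) : iIndepFun (fun (x : Lat L n) ω => unitNoise ξ L n ω x) P := by
  refine (hξ.hasGaussianLaw_unitNoise n).iIndepFun_of_covariance_eq_zero fun x y hxy => ?_
  rw [covariance_eq_sub (hξ.memLp_unitNoise n x) (hξ.memLp_unitNoise n y),
    hξ.integral_unitNoise n x, zero_mul, sub_zero]
  refine (hξ.integral_unitNoise_mul x y).trans ?_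
  rw [if_neg hxy]

omit [IsProbabilityMeasure P] in
/-- Almost surely, the unit noises on all scales are consistent. -/
lemma ae_consistent : ∀ᵐ ω ∂P, ∀ n (x : Lat L n),
    latAvg L (n + 1) n (unitNoise ξ L (n + 1) ω) x = unitNoise ξ L n ω x / L := by
  have hL := L_pos (L := L)
  refine ae_all_iff.2 fun n => ae_all_iff.2 fun x => ?_
  classical
  filter_upwards [hξ.ae_eq_sum (Finset.univ.filter fun y : Lat L (n + 1) => anc L (n + 1) n y = x)
    (boxInd L (n + 1))] with ω hω
  have e : boxInd L n x
      = ∑ y : Lat L (n + 1) with anc L (n + 1) n y = x, boxInd L (n + 1) y := by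
    rw [boxInd_eq_sum (Nat.le_succ n) x]
  rw [latAvg_eq, unitNoise_eq, e, hω]
  simp only [unitNoise_eq, ← Finset.mul_sum]
  rw [show n + 1 - n = 1 by omega, pow_succ]
  field_simp
  ring

omit [IsProbabilityMeasure P] in
lemma integrable_unitNoise_mul {n : ℕ} (x y : Lat L n) :
    Integrable (fun ω => unitNoise ξ L n ω x * unitNoise ξ L n ω y) P :=
  (hξ.memLp_unitNoise n x).integrable_mul (hξ.memLp_unitNoise n y)

omit [IsProbabilityMeasure P] in
lemma integral_unitNoise_mul_latAvg {n N : ℕ} (y : Lat L N) :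
    Integrable (fun ω => unitNoise ξ L N ω y * latAvg L N n (unitNoise ξ L N ω) (anc L N n y)) P ∧
      ∫ ω, unitNoise ξ L N ω y * latAvg L N n (unitNoise ξ L N ω) (anc L N n y) ∂P
        = ((L : ℝ) ^ (2 * (N - n)))⁻¹ := by
  have e : (fun ω => unitNoise ξ L N ω y * latAvg L N n (unitNoise ξ L N ω) (anc L N n y))
      = fun ω => ((L : ℝ) ^ (2 * (N - n)))⁻¹ * ∑ y' : Lat L N with anc L N n y' = anc L N n y,
        unitNoise ξ L N ω y * unitNoise ξ L N ω y' := by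
    funext ω
    rw [latAvg_eq, ← Finset.mul_sum]
    ring
  rw [e]
  refine ⟨(integrable_finsetSum _ fun y' _ => hξ.integrable_unitNoise_mul y y').const_mul _, ?_⟩
  rw [integral_const_mul, integral_finsetSum _ fun y' _ => hξ.integrable_unitNoise_mul y y',
    Finset.sum_congr rfl fun y' _ => hξ.integral_unitNoise_mul y y']
  simp

omit [IsProbabilityMeasure P] in
/-- The expectation subtracted in the second chaos, which the counterterm reproduces. -/
lemma integral_unitNoise_mul_propagator {n N : ℕ} (h : n ≤ N) (y : Lat L N) :
    Integrable (fun ω => unitNoise ξ L N ω y * propagator L N n (unitNoise ξ L N ω) y) P ∧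
      ∫ ω, unitNoise ξ L N ω y * propagator L N n (unitNoise ξ L N ω) y ∂P
        = (N - n : ℕ) * (1 - ((L : ℝ) ^ 2)⁻¹) := by
  have hL := L_pos (L := L)
  induction h using Nat.decreasingInduction with
  | self => simp [propagator_self]
  | of_succ j hj ih =>
    obtain ⟨i1, e1⟩ := ih
    obtain ⟨i2, e2⟩ := hξ.integral_unitNoise_mul_latAvg (n := j + 1) y
    obtain ⟨i3, e3⟩ := hξ.integral_unitNoise_mul_latAvg (n := j) y
    have e : (fun ω => unitNoise ξ L N ω y * propagator L N j (unitNoise ξ L N ω) y)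
        = fun ω => unitNoise ξ L N ω y * propagator L N (j + 1) (unitNoise ξ L N ω) y
          + (L : ℝ) ^ (2 * (N - (j + 1))) *
            (unitNoise ξ L N ω y * latAvg L N (j + 1) (unitNoise ξ L N ω) (anc L N (j + 1) y)
              - unitNoise ξ L N ω y * latAvg L N j (unitNoise ξ L N ω) (anc L N j y)) := by
      funext ω
      rw [propagator_of_lt hj]
      ring
    have i4 := (i2.sub i3).const_mul ((L : ℝ) ^ (2 * (N - (j + 1))))
    rw [e]
    refine ⟨i1.add i4, (integral_add i1 i4).trans ?_⟩
    rw [e1, integral_const_mul]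
    have e5 := integral_sub i2 i3
    rw [e2, e3] at e5
    refine (congrArg (fun t => _ + _ * t) e5).trans ?_
    rw [show N - j = N - (j + 1) + 1 by omega, mul_add 2, pow_add]
    push_cast
    field_simp

omit [IsProbabilityMeasure P] in
/-- On consistent realisations, the second chaos satisfies its recursion over the scales. -/
lemma secondChaos_eq {ω : Ω} (hc : ∀ n (x : Lat L n),
      latAvg L (n + 1) n (unitNoise ξ L (n + 1) ω) x = unitNoise ξ L n ω x / L)
    {n N : ℕ} (h : n ≤ N) (x : Lat L n) :
    secondChaos ξ P L N n ω x = chaos L (fun n => unitNoise ξ L n ω) (N - n) n x := by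
  rw [← latAvg_mul_propagator (ζ := fun n => unitNoise ξ L n ω) hc h x, secondChaos]
  congr 1
  funext y
  rw [(hξ.integral_unitNoise_mul_propagator h y).2]

lemma measureReal_wickAvg_le {n j : ℕ} (h : n ≤ j) (x : Lat L n) (a : ℝ) :
    P.real {ω | a < |wickAvg L (fun n => unitNoise ξ L n ω) n x j|}
      ≤ 3 * Real.exp (-((L : ℝ) ^ (j - n) * a / 4)) := by
  have hL1 : (1 : ℝ) ≤ L := by exact_mod_cast Nat.pos_of_ne_zero (NeZero.ne L)
  classical
  have hcard := card_children h x
  simp only [pt_mem_box_iff] at hcard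
  rw [pow_mul'] at hcard
  have := measureReal_wick_avg_le (hξ.iIndepFun_unitNoise j) (fun y => hξ.map_unitNoise y)
    (fun y => (hξ.memLp_unitNoise j y).aemeasurable)
    (Finset.univ.filter fun y : Lat L j => anc L j n y = x)
    (one_le_pow₀ hL1 : 1 ≤ (L : ℝ) ^ (j - n)) hcard a
  simp only [wickAvg, latAvg_eq]
  simp only [← pow_mul'] at this
  convert! this

lemma measureReal_sq_unitNoise_le {n : ℕ} (x : Lat L n) (a : ℝ) :
    P.real {ω | a < unitNoise ξ L n ω x ^ 2} ≤ 5 * Real.exp (-(a / 4)) := by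
  have h := hξ.measureReal_wickAvg_le le_rfl x (a - 1)
  have hsub : {ω | a < unitNoise ξ L n ω x ^ 2}
      ⊆ {ω | a - 1 < |wickAvg L (fun n => unitNoise ξ L n ω) n x n|} := by
    intro ω hω
    have e : wickAvg L (fun n => unitNoise ξ L n ω) n x n = unitNoise ξ L n ω x ^ 2 - 1 :=
      congrFun (latAvg_self _) x
    simp only [mem_ofPred_eq, e] at hω ⊢
    exact lt_of_lt_of_le (by linarith) (le_abs_self _)
  refine (measureReal_mono hsub).trans (h.trans ?_)
  have e : -((L : ℝ) ^ (n - n) * (a - 1) / 4) = -(a / 4) + 1 / 4 := by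
    rw [Nat.sub_self]; ring
  rw [e, Real.exp_add]
  nlinarith [exp_quarter_le, Real.exp_pos (-(a / 4))]

end IsWhiteNoise

end WhiteNoise

/-! ### The probability of the good event -/

section UnionBounds

variable {Ω : Type*} [MeasurableSpace Ω] {P : Measure Ω} [IsProbabilityMeasure P]

lemma measureReal_iUnion_le_tsum {s : ℕ → Set Ω} {f : ℕ → ℝ} (hf : Summable f)
    (h : ∀ i, P.real (s i) ≤ f i) : P.real (⋃ i, s i) ≤ ∑' i, f i := by
  have h0 : ∀ i, 0 ≤ f i := fun i => measureReal_nonneg.trans (h i)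
  rw [measureReal_def]
  refine ENNReal.toReal_le_of_le_ofReal (tsum_nonneg h0) ?_
  rw [ENNReal.ofReal_tsum_of_nonneg h0 hf]
  refine (measure_iUnion_le s).trans (ENNReal.tsum_le_tsum fun i => ?_)
  rw [← ofReal_measureReal]
  exact ENNReal.ofReal_le_ofReal (h i)

lemma ae_eventually_notMem_of_summable {s : ℕ → Set Ω} {f : ℕ → ℝ} (hf : Summable f)
    (h : ∀ i, P.real (s i) ≤ f i) : ∀ᵐ ω ∂P, ∀ᶠ i in atTop, ω ∉ s i := by
  refine ae_eventually_notMem (ne_top_of_le_ne_top hf.tsum_ofReal_ne_top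
    (ENNReal.tsum_le_tsum fun i => ?_))
  rw [← ofReal_measureReal]
  exact ENNReal.ofReal_le_ofReal (h i)

omit [IsProbabilityMeasure P] in
lemma measureReal_iUnion_lat_le {L n : ℕ} {s : Lat L n → Set Ω} {a : ℝ}
    (h : ∀ x, P.real (s x) ≤ a) : P.real (⋃ x, s x) ≤ ((L : ℝ) ^ n) ^ 2 * a := by
  refine (measureReal_iUnion_fintype_le s).trans ((Finset.sum_le_sum fun x _ => h x).trans ?_)
  simp

end UnionBounds

lemma summable_pow_mul_exp_neg_pow {x b : ℝ} (hx : 0 < x) (hb : 1 < b) :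
    Summable fun n : ℕ => (x ^ n) ^ 2 * Real.exp (-(b ^ (2 * n) / 128)) := by
  have hb2 : 1 < b ^ 2 := one_lt_pow₀ hb (by norm_num)
  set A := 128 * (2 * Real.log x + 1) with hA
  have hlim : Tendsto (fun n : ℕ => A * ((n : ℝ) * ((b ^ 2)⁻¹) ^ n)) atTop (𝓝 (A * 0)) :=
    (tendsto_self_mul_const_pow_of_lt_one (by positivity) (inv_lt_one_of_one_lt₀ hb2)).const_mul A
  rw [mul_zero] at hlim
  have hs : Summable fun n : ℕ => Real.exp (-1) ^ n :=
    summable_geometric_of_lt_one (Real.exp_pos _).le (Real.exp_lt_one_iff.2 (by norm_num))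
  refine hs.of_norm_bounded_eventually_nat ?_
  filter_upwards [hlim.eventually (ge_mem_nhds one_pos)] with n hn
  rw [inv_pow, ← mul_assoc, ← div_eq_mul_inv, div_le_one (by positivity), ← pow_mul] at hn
  rw [Real.norm_of_nonneg (by positivity), ← Real.exp_nat_mul]
  nth_rw 1 [← Real.exp_log hx]
  rw [← Real.exp_nat_mul, ← Real.exp_nat_mul, ← Real.exp_add, Real.exp_le_exp]
  rw [hA] at hn
  push_cast
  nlinarith

lemma one_add_half_le_pow {x : ℝ} (hx : 3 ≤ x) (i : ℕ) :
    1 + (i : ℝ) / 2 ≤ x ^ i * (1 / 2) ^ i := by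
  have h := one_add_mul_le_pow (a := (1 / 2 : ℝ)) (by norm_num) i
  rw [← mul_pow]
  have : (1 + 1 / 2 : ℝ) ^ i ≤ (x * (1 / 2)) ^ i :=
    pow_le_pow_left₀ (by norm_num) (by linarith) i
  linarith

namespace IsWhiteNoise

variable {Ω : Type*} [MeasurableSpace Ω] {P : Measure Ω} [IsProbabilityMeasure P]
  {ξ : Lp ℝ 2 torusMeasure → Ω → ℝ} {L : ℕ} [NeZero L] (hξ : IsWhiteNoise ξ P)
include hξ

/-- Almost surely the unit noise grows at most linearly in the scale, by the Borel–Cantelli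
lemma. -/
lemma ae_growth : ∀ᵐ ω ∂P, ∃ K : ℝ, ∀ n (x : Lat L n), |unitNoise ξ L n ω x| ≤ K * (n + 1) := by
  have hL := L_pos (L := L)
  set θ := ((L : ℝ) * Real.exp (-L)) ^ 2 with hθ
  have hθ1 : θ < 1 := by
    refine pow_lt_one₀ (by positivity) ?_ (by norm_num)
    rw [Real.exp_neg, ← div_eq_mul_inv, div_lt_one (Real.exp_pos _)]
    linarith [Real.add_one_le_exp (L : ℝ)]
  have hsum : Summable fun n : ℕ => 5 * θ ^ n :=
    (summable_geometric_of_lt_one (by positivity) hθ1).mul_left 5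
  have hle : ∀ n, P.real (⋃ x : Lat L n, {ω | 8 * (L : ℝ) * (n + 1) < unitNoise ξ L n ω x ^ 2})
      ≤ 5 * θ ^ n := by
    intro n
    refine (measureReal_iUnion_lat_le fun x => hξ.measureReal_sq_unitNoise_le x _).trans ?_
    have e : θ ^ n = ((L : ℝ) ^ n) ^ 2 * Real.exp (-(2 * L * n)) := by
      rw [hθ, ← pow_mul, mul_comm 2 n, pow_mul, mul_pow, mul_pow, ← Real.exp_nat_mul,
        ← Real.exp_nat_mul]
      congr 2
      push_cast
      ring
    have e2 : Real.exp (-(8 * (L : ℝ) * (n + 1) / 4)) ≤ Real.exp (-(2 * L * n)) := by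
      rw [Real.exp_le_exp]; linarith
    have := mul_le_mul_of_nonneg_left e2 (by positivity : 0 ≤ ((L : ℝ) ^ n) ^ 2)
    rw [e]
    linarith
  filter_upwards [ae_eventually_notMem_of_summable hsum hle] with ω hω
  obtain ⟨n₀, hn₀⟩ := eventually_atTop.1 hω
  set B := ∑ n ∈ Finset.range n₀, ∑ x : Lat L n, |unitNoise ξ L n ω x| with hB
  have hB0 : 0 ≤ B := Finset.sum_nonneg fun n _ => Finset.sum_nonneg fun x _ => abs_nonneg _
  refine ⟨1 + 8 * L + B, fun n x => ?_⟩
  have hn : (0 : ℝ) ≤ n := Nat.cast_nonneg n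
  rcases lt_or_ge n n₀ with h | h
  · have h1 : |unitNoise ξ L n ω x| ≤ B :=
      (Finset.single_le_sum (f := fun x : Lat L n => |unitNoise ξ L n ω x|)
        (fun y _ => abs_nonneg _) (Finset.mem_univ x)).trans
      (Finset.single_le_sum (f := fun n => ∑ x : Lat L n, |unitNoise ξ L n ω x|)
        (fun m _ => Finset.sum_nonneg fun y _ => abs_nonneg _) (Finset.mem_range.2 h))
    nlinarith
  · have h1 := hn₀ n h
    simp only [mem_iUnion, mem_ofPred_eq, not_exists, not_lt] at h1
    have h2 := h1 x
    have h3 : |unitNoise ξ L n ω x| ≤ 1 + unitNoise ξ L n ω x ^ 2 := by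
      rw [← sq_abs]; nlinarith [sq_nonneg (|unitNoise ξ L n ω x| - 1)]
    nlinarith

/-- Almost surely the second chaos converges as the cutoff is removed. -/
lemma ae_exists_tendsto_chaos (hL : 3 ≤ L) : ∀ᵐ ω ∂P, ∀ n (x : Lat L n),
    ∃ l, Tendsto (fun k => chaos L (fun n => unitNoise ξ L n ω) k n x) atTop (𝓝 l) := by
  refine ae_all_iff.2 fun n => ae_all_iff.2 fun x => ?_
  have hsum : Summable fun i : ℕ => 3 * Real.exp (-1 / 8) ^ i :=
    (summable_geometric_of_lt_one (Real.exp_pos _).le (Real.exp_lt_one_iff.2 (by norm_num))).mul_left 3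
  have hle : ∀ i, P.real {ω | (1 / 2 : ℝ) ^ i
      < |wickAvg L (fun n => unitNoise ξ L n ω) n x (n + i)|} ≤ 3 * Real.exp (-1 / 8) ^ i := by
    intro i
    refine (hξ.measureReal_wickAvg_le (Nat.le_add_right n i) x _).trans ?_
    rw [← Real.exp_nat_mul, Nat.add_sub_cancel_left]
    have h1 := one_add_half_le_pow (x := (L : ℝ)) (by exact_mod_cast hL) i
    have : Real.exp (-((L : ℝ) ^ i * (1 / 2) ^ i / 4)) ≤ Real.exp (i * (-1 / 8)) := by
      rw [Real.exp_le_exp]; linarith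
    linarith
  filter_upwards [ae_eventually_notMem_of_summable hsum hle] with ω hω
  exact exists_tendsto_chaos (hω.mono fun i hi => not_lt.1 hi)

lemma measureReal_exists_wickAvg_le (hL : 3 ≤ L) {n : ℕ} (x : Lat L n) {a : ℝ} (ha : 1 / 4 ≤ a) :
    P.real (⋃ i : ℕ, {ω | a * (1 / 2) ^ i / 4
      < |wickAvg L (fun n => unitNoise ξ L n ω) n x (n + i)|})
      ≤ 3 * (1 - Real.exp (-1 / 128))⁻¹ * Real.exp (-(a / 16)) := by
  have hr1 : Real.exp (-1 / 128) < 1 := Real.exp_lt_one_iff.2 (by norm_num)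
  have hsum : Summable fun i : ℕ => 3 * Real.exp (-(a / 16)) * Real.exp (-1 / 128) ^ i :=
    (summable_geometric_of_lt_one (Real.exp_pos _).le hr1).mul_left _
  refine (measureReal_iUnion_le_tsum hsum fun i => ?_).trans (le_of_eq ?_)
  · refine (hξ.measureReal_wickAvg_le (Nat.le_add_right n i) x _).trans ?_
    rw [mul_assoc, ← Real.exp_nat_mul, ← Real.exp_add, Nat.add_sub_cancel_left]
    have h1 := one_add_half_le_pow (x := (L : ℝ)) (by exact_mod_cast hL) i
    have h2 := mul_le_mul_of_nonneg_left h1 (by linarith : 0 ≤ a)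
    have hi : (0 : ℝ) ≤ i := Nat.cast_nonneg i
    have : Real.exp (-((L : ℝ) ^ i * (a * (1 / 2) ^ i / 4) / 4))
        ≤ Real.exp (-(a / 16) + i * (-1 / 128)) := by
      rw [Real.exp_le_exp]; nlinarith
    linarith
  · rw [tsum_mul_left, tsum_geometric_of_lt_one (Real.exp_pos _).le hr1]
    ring

omit [IsProbabilityMeasure P] in
lemma aemeasurable_wickAvg (n : ℕ) (x : Lat L n) (j : ℕ) :
    AEMeasurable (fun ω => wickAvg L (fun n => unitNoise ξ L n ω) n x j) P := by
  simp only [wickAvg, latAvg]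
  exact (Finset.aemeasurable_fun_sum _ fun y _ =>
    ((hξ.memLp_unitNoise j y).aemeasurable.pow_const 2).sub_const 1).const_mul _

omit [IsProbabilityMeasure P] in
lemma nullMeasurableSet_goodEvent (κs g : ℝ) :
    NullMeasurableSet (goodEvent ξ P L κs g) P := by
  have hS : ∀ N n, n ≤ N → ∀ x : Lat L n,
      AEMeasurable (fun ω => secondChaos ξ P L N n ω x) P := by
    intro N n hn x
    have h1 : AEMeasurable (fun ω => chaos L (fun n => unitNoise ξ L n ω) (N - n) n x) P := by
      simp only [chaos_eq_sum]
      exact Finset.aemeasurable_fun_sum _ fun i _ => (hξ.aemeasurable_wickAvg n x _).sub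
        ((hξ.aemeasurable_wickAvg n x _).const_mul _)
    refine h1.congr ?_
    filter_upwards [hξ.ae_consistent (L := L)] with ω hω
    exact (hξ.secondChaos_eq hω hn x).symm
  have hm : AEMeasurable (noiseNorm ξ P L κs) P := by
    unfold noiseNorm
    refine AEMeasurable.iSup fun N => AEMeasurable.iSup fun n => AEMeasurable.iSup fun hn =>
      AEMeasurable.iSup fun x => ?_
    refine ENNReal.measurable_ofReal.comp_aemeasurable (AEMeasurable.const_mul ?_ _)
    have h1 := (hξ.memLp_unitNoise n x).aemeasurable
    have h2 := hS N n hn x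
    exact (measurable_norm.comp_aemeasurable h1).max
      (Real.continuous_sqrt.measurable.comp_aemeasurable (measurable_norm.comp_aemeasurable h2))
  exact hm.nullMeasurable measurableSet_Iic

/-- The complement of the good event is exponentially small in `g⁻²`. -/
lemma measureReal_goodEvent_ge (hL : 3 ≤ L) {κs : ℝ} (hκs : 0 < κs) {g : ℝ} (hg0 : 0 < g)
    (hg1 : g ≤ 1) :
    1 - (5 + 3 * (1 - Real.exp (-1 / 128))⁻¹) *
        (∑' n : ℕ, (((L : ℝ) ^ n) ^ 2 * Real.exp (-(((L : ℝ) ^ κs) ^ (2 * n) / 128)))) *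
        Real.exp (-(g ^ 2)⁻¹ / 128)
      ≤ P.real (goodEvent ξ P L κs g) := by
  have hL3 : (3 : ℝ) ≤ L := by exact_mod_cast hL
  have hL0 : (0 : ℝ) < L := by linarith
  set b := (L : ℝ) ^ κs with hb
  have hb1 : 1 < b := Real.one_lt_rpow (by linarith) hκs
  set Q := 5 + 3 * (1 - Real.exp (-1 / 128))⁻¹ with hQ
  have hr1 : Real.exp (-1 / 128) < 1 := Real.exp_lt_one_iff.2 (by norm_num)
  have hQ0 : 0 ≤ Q := by
    have : 0 ≤ (1 - Real.exp (-1 / 128))⁻¹ := inv_nonneg.2 (by linarith)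
    positivity
  have hg2 : 1 ≤ (g ^ 2)⁻¹ := by
    rw [one_le_inv₀ (by positivity)]; exact pow_le_one₀ hg0.le hg1
  set lam : ℕ → ℝ := fun n => b ^ (2 * n) * (g ^ 2)⁻¹ / 4 with hlam
  have hbn : ∀ n : ℕ, 1 ≤ b ^ (2 * n) := fun n => one_le_pow₀ hb1.le
  have hlam4 : ∀ n, 1 / 4 ≤ lam n := fun n => by
    simp only [hlam]; nlinarith [hbn n]
  set bad : ∀ n, Lat L n → Set Ω := fun n x => {ω | lam n < unitNoise ξ L n ω x ^ 2} ∪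
    ⋃ i : ℕ, {ω | lam n * (1 / 2) ^ i / 4
      < |wickAvg L (fun n => unitNoise ξ L n ω) n x (n + i)|} with hbad
  have hbadP : ∀ n x, P.real (bad n x) ≤ Q * Real.exp (-(lam n / 16)) := by
    intro n x
    refine (measureReal_union_le _ _).trans ?_
    have h1 := hξ.measureReal_sq_unitNoise_le x (lam n)
    have h2 := hξ.measureReal_exists_wickAvg_le hL x (hlam4 n)
    have h3 : Real.exp (-(lam n / 4)) ≤ Real.exp (-(lam n / 16)) := by
      rw [Real.exp_le_exp]; linarith [hlam4 n]
    rw [hQ, add_mul]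
    linarith
  have hexp : ∀ n, Real.exp (-(lam n / 16))
      ≤ Real.exp (-(b ^ (2 * n) / 128)) * Real.exp (-(g ^ 2)⁻¹ / 128) := by
    intro n
    rw [← Real.exp_add, Real.exp_le_exp]
    simp only [hlam]
    -- `x y ≥ (x + y) / 2` for `x, y ≥ 1`
    nlinarith [mul_nonneg (sub_nonneg.2 (hbn n)) (sub_nonneg.2 hg2),
      one_le_mul_of_one_le_of_one_le (hbn n) hg2]
  have hsum := (summable_pow_mul_exp_neg_pow hL0 hb1).mul_left (Q * Real.exp (-(g ^ 2)⁻¹ / 128))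
  have hP : P.real (⋃ n, ⋃ x, bad n x) ≤ ∑' n : ℕ, Q * Real.exp (-(g ^ 2)⁻¹ / 128) *
      (((L : ℝ) ^ n) ^ 2 * Real.exp (-(b ^ (2 * n) / 128))) := by
    refine measureReal_iUnion_le_tsum hsum fun n => ?_
    refine (measureReal_iUnion_lat_le (hbadP n)).trans ?_
    calc ((L : ℝ) ^ n) ^ 2 * (Q * Real.exp (-(lam n / 16)))
        ≤ ((L : ℝ) ^ n) ^ 2 * (Q * (Real.exp (-(b ^ (2 * n) / 128))
          * Real.exp (-(g ^ 2)⁻¹ / 128))) := by gcongr; exact hexp n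
      _ = _ := by ring
  rw [tsum_mul_left] at hP
  set inc : Set Ω := {ω | ¬ ∀ n (x : Lat L n),
    latAvg L (n + 1) n (unitNoise ξ L (n + 1) ω) x = unitNoise ξ L n ω x / L} with hinc
  have hinc0 : P.real inc = 0 := by
    rw [measureReal_def, show P inc = 0 from hξ.ae_consistent, ENNReal.toReal_zero]
  have hcover : (univ : Set Ω) ⊆ goodEvent ξ P L κs g ∪ ((⋃ n, ⋃ x, bad n x) ∪ inc) := by
    intro ω _
    by_contra hω
    simp only [mem_union, not_or, hinc, hbad, mem_iUnion, mem_ofPred_eq, not_exists, not_lt,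
      not_not] at hω
    obtain ⟨hω1, hω2, hcons⟩ := hω
    refine hω1 (show noiseNorm ξ P L κs ω ≤ _ from ?_)
    refine iSup_le fun N => iSup_le fun n => iSup_le fun hn => iSup_le fun x => ?_
    refine ENNReal.ofReal_le_ofReal ?_
    obtain ⟨k1, k2⟩ := hω2 n x
    have hbn0 : 0 < b ^ n := by positivity
    have e1 : (L : ℝ) ^ (-κs * n) = (b ^ n)⁻¹ := by
      rw [hb, ← Real.rpow_mul_natCast hL0.le, ← Real.rpow_neg hL0.le, neg_mul]
    have e2 : lam n = (b ^ n / (2 * g)) ^ 2 := by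
      simp only [hlam]
      rw [pow_mul' b, div_pow, mul_pow]
      field_simp
      norm_num
    have hpos : 0 ≤ b ^ n / (2 * g) := by positivity
    have k3 : |unitNoise ξ L n ω x| ≤ b ^ n / (2 * g) := by
      rw [e2] at k1; exact abs_le_of_sq_le_sq k1 hpos
    have k4 : √|secondChaos ξ P L N n ω x| ≤ b ^ n / (2 * g) := by
      rw [Real.sqrt_le_left hpos, hξ.secondChaos_eq hcons hn, ← e2]
      exact abs_chaos_le hL (by linarith [hlam4 n]) k2 _
    rw [e1, inv_mul_le_iff₀ hbn0]
    refine (max_le k3 k4).trans (le_of_eq ?_)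
    ring
  have h1 : (1 : ℝ) ≤ P.real (goodEvent ξ P L κs g) + P.real (⋃ n, ⋃ x, bad n x) := by
    have h2 := measureReal_mono (μ := P) hcover
    rw [probReal_univ] at h2
    have h3 := measureReal_union_le (μ := P) (goodEvent ξ P L κs g) ((⋃ n, ⋃ x, bad n x) ∪ inc)
    have h4 := measureReal_union_le (μ := P) (⋃ n, ⋃ x, bad n x) inc
    linarith
  linarith

omit [IsProbabilityMeasure P] in
/-- Consistent realisations in the good event are regular. -/
lemma isRegular_of_mem_goodEvent {κs r g : ℝ} (hκs : 0 < κs) (hr : 1 ≤ r) (hg0 : 0 < g)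
    (hg1 : g ≤ 1) (hL : 2000 * r * ((L : ℝ) ^ κs) ^ 3 ≤ L) {ω : Ω}
    (hω : ω ∈ goodEvent ξ P L κs g) (hc : ∀ n (x : Lat L n),
      latAvg L (n + 1) n (unitNoise ξ L (n + 1) ω) x = unitNoise ξ L n ω x / L) :
    IsRegular L r g ((L : ℝ) ^ κs) (fun n => unitNoise ξ L n ω) := by
  have hL0 := L_pos (L := L)
  set b := (L : ℝ) ^ κs with hb
  have hb1 : 1 ≤ b :=
    Real.one_le_rpow (by exact_mod_cast Nat.pos_of_ne_zero (NeZero.ne L)) hκs.le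
  have key : ∀ N n, n ≤ N → ∀ x : Lat L n,
      max |unitNoise ξ L n ω x| (√|secondChaos ξ P L N n ω x|) ≤ b ^ n / (2 * g) := by
    intro N n hn x
    have h1 : ENNReal.ofReal ((L : ℝ) ^ (-κs * n) *
        max |unitNoise ξ L n ω x| (√|secondChaos ξ P L N n ω x|))
        ≤ ENNReal.ofReal (1 / (2 * g)) := by
      refine le_trans ?_ hω
      exact le_iSup_of_le N (le_iSup_of_le n (le_iSup_of_le hn (le_iSup_of_le x le_rfl)))
    rw [ENNReal.ofReal_le_ofReal_iff (by positivity)] at h1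
    have e1 : (L : ℝ) ^ (-κs * n) = (b ^ n)⁻¹ := by
      rw [hb, ← Real.rpow_mul_natCast hL0.le, ← Real.rpow_neg hL0.le, neg_mul]
    rw [e1, inv_mul_le_iff₀ (by positivity)] at h1
    refine h1.trans (le_of_eq ?_)
    ring
  refine ⟨hr, hg0, hg1, hb1, hL, hc, fun n x => ?_, fun k n x => ?_⟩
  · have h1 := (le_max_left _ _).trans (key n n le_rfl x)
    rw [le_div_iff₀ (by positivity)] at h1
    rw [abs_mul, abs_of_pos hg0]
    linarith
  · have h1 := (le_max_right _ _).trans (key (n + k) n (by omega) x)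
    rw [hξ.secondChaos_eq hc (by omega), Nat.add_sub_cancel_left,
      Real.sqrt_le_left (by positivity), div_pow, mul_pow, le_div_iff₀ (by positivity),
      ← pow_mul, mul_comm n 2] at h1
    rw [abs_mul, abs_of_pos (by positivity)]
    linarith

end IsWhiteNoise

/-- For `κs < 1 / 4` a sufficiently large `L` satisfies the smallness condition of the flow. -/
lemma mul_rpow_cube_le {κs r x : ℝ} (hκs : κs < 1 / 4) (hr : 1 ≤ r)
    (hx : (2000 * r) ^ 4 ≤ x) : 2000 * r * (x ^ κs) ^ 3 ≤ x := by
  have h1 : (1 : ℝ) ≤ (2000 * r) ^ 4 := one_le_pow₀ (by linarith)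
  have hx1 : 1 ≤ x := h1.trans hx
  have h2 : 2000 * r ≤ x ^ (1 / 4 : ℝ) := by
    have h3 := Real.rpow_le_rpow (by positivity) hx (by norm_num : (0 : ℝ) ≤ 1 / 4)
    rwa [← Real.rpow_natCast_mul (by positivity), show ((4 : ℕ) : ℝ) * (1 / 4) = 1 by norm_num,
      Real.rpow_one] at h3
  have h4 : (x ^ κs) ^ 3 ≤ x ^ (3 / 4 : ℝ) := by
    rw [← Real.rpow_mul_natCast (by linarith)]
    refine Real.rpow_le_rpow_of_exponent_le hx1 ?_
    push_cast
    linarith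
  calc 2000 * r * (x ^ κs) ^ 3 ≤ x ^ (1 / 4 : ℝ) * x ^ (3 / 4 : ℝ) :=
        mul_le_mul h2 h4 (by positivity) (by positivity)
    _ = x := by rw [← Real.rpow_add (by linarith)]; norm_num

end HierAnderson
end

open HierAnderson
theorem theorem1p1 :
    ∃ κ₀ : ℝ, 0 < κ₀ ∧ ∀ κs : ℝ, 0 < κs → κs < κ₀ → ∀ r : ℝ, 1 ≤ r →
    ∃ L₀ : ℕ, ∀ L : ℕ, Odd L → 3 ≤ L → L₀ ≤ L →
    ∃ C c : ℝ, 0 < C ∧ 0 < c ∧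
    ∀ (Ω : Type*) [MeasurableSpace Ω] (P : Measure Ω) [IsProbabilityMeasure P]
      (ξ : Lp ℝ 2 torusMeasure → Ω → ℝ), IsWhiteNoise ξ P →
    ∀ g : ℝ, 0 < g → g ≤ 1 →
    ∃ Ωg : Set Ω, MeasurableSet Ωg ∧
      Ωg ⊆ goodEvent ξ P L κs g ∧ P (goodEvent ξ P L κs g \ Ωg) = 0 ∧
      1 - C * Real.exp (-c * (g ^ 2)⁻¹) ≤ P.real Ωg ∧
      ∀ ω ∈ Ωg, ∃ u : (N : ℕ) → Lat L N → ℝ,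
        (∀ N, IsSolution ξ L r g N ω (u N) ∧ ∀ v, IsSolution ξ L r g N ω v → v = u N) ∧
        ∃ uStar : (Fin 2 → ℝ) → ℝ, ∀ κ : ℝ, 0 < κ → κ < 1 →
          MemBesov L (1 - κ) uStar ∧
          Tendsto (fun N => besovNorm L (1 - κ) (fun y => step L N (u N) y - uStar y))
            atTop (𝓝 0) := by
  refine ⟨1 / 4, by norm_num, fun κs hκs0 hκs1 r hr => ⟨⌈(2000 * r) ^ 4⌉₊, fun L _ hL3 hL₀ => ?_⟩⟩
  have : NeZero L := ⟨by omega⟩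
  have hLr : 2000 * r * ((L : ℝ) ^ κs) ^ 3 ≤ L :=
    mul_rpow_cube_le hκs1 hr ((Nat.le_ceil _).trans (by exact_mod_cast hL₀))
  set C₀ := (5 + 3 * (1 - Real.exp (-1 / 128))⁻¹) *
    (∑' n : ℕ, (((L : ℝ) ^ n) ^ 2 * Real.exp (-(((L : ℝ) ^ κs) ^ (2 * n) / 128)))) with hC₀
  have hC₀0 : 0 ≤ C₀ := by
    have : Real.exp (-1 / 128) < 1 := Real.exp_lt_one_iff.2 (by norm_num)
    have : 0 ≤ (1 - Real.exp (-1 / 128))⁻¹ := inv_nonneg.2 (by linarith)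
    have : 0 ≤ ∑' n : ℕ, (((L : ℝ) ^ n) ^ 2 * Real.exp (-(((L : ℝ) ^ κs) ^ (2 * n) / 128))) :=
      tsum_nonneg fun n => by positivity
    positivity
  refine ⟨C₀ + 1, 1 / 128, by linarith, by norm_num, fun Ω _ P _ ξ hξ g hg0 hg1 => ?_⟩
  -- the good event without the null set on which consistency, growth or convergence fails
  set A : Set Ω := {ω | (∀ n (x : Lat L n),
      latAvg L (n + 1) n (unitNoise ξ L (n + 1) ω) x = unitNoise ξ L n ω x / L) ∧
    (∃ K : ℝ, ∀ n (x : Lat L n), |unitNoise ξ L n ω x| ≤ K * (n + 1)) ∧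
    ∀ n (x : Lat L n),
      ∃ l, Tendsto (fun k => chaos L (fun n => unitNoise ξ L n ω) k n x) atTop (𝓝 l)} with hA
  have hAae : ∀ᵐ ω ∂P, ω ∈ A :=
    hξ.ae_consistent.and (hξ.ae_growth.and (hξ.ae_exists_tendsto_chaos hL3))
  have hgA : (goodEvent ξ P L κs g ∩ A : Set Ω) =ᵐ[P] goodEvent ξ P L κs g :=
    inter_ae_eq_left_of_ae_eq_univ (eventuallyEq_univ.2 hAae)
  obtain ⟨Ωg, hsub, hmeas, hae⟩ :=
    ((hξ.nullMeasurableSet_goodEvent κs g).congr hgA.symm).exists_measurable_subset_ae_eq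
  have hae' := hae.trans hgA
  refine ⟨Ωg, hmeas, hsub.trans inter_subset_left, ae_le_set.1 hae'.symm.le, ?_, fun ω hω => ?_⟩
  · rw [measureReal_congr hae']
    refine le_trans ?_ (hξ.measureReal_goodEvent_ge hL3 hκs0 hg0 hg1)
    have e : -(1 / 128) * (g ^ 2)⁻¹ = -(g ^ 2)⁻¹ / 128 := by ring
    rw [e, ← hC₀]
    linarith [Real.exp_pos (-(g ^ 2)⁻¹ / 128)]
  · obtain ⟨hgood, hcons, hgrow, hconv⟩ := hsub hω
    have hreg := hξ.isRegular_of_mem_goodEvent hκs0 hr hg0 hg1 hLr hgood hcons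
    have heq : ∀ N (x : Lat L N), effPot L r g (fun n => unitNoise ξ L n ω) 0 N x
        = g * latNoise ξ L N ω x + (r - (1 - ((L : ℝ) ^ 2)⁻¹) * N * g ^ 2) := fun N x => by
      rw [effPot, latNoise_eq]
    have hex := hreg.exists_solution hconv hgrow
    simp only [heq] at hex
    exact hex
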